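/- **Setting.** For each dimension $p\ge 1$ let $n=n_p$ be given, and let $U=U_p$ be a fixed $n\times p$ matrix with orthonormal columns, a basis of the regression space $\mathcal M_p\subset\mathbb R^{n}$ (for instance a penalty basis). One observes $y\sim N(\eta,\sigma^2 I_n)$ with $\eta\in\mathcal M_p$. Put $\xi=U'\eta$ (so $\eta=U\xi$) and $z=U'y$. The normalized quadratic risk of an estimator $\hat\eta=\hat\eta(y)$ is $R(\hat\eta,\eta,\sigma^2)=p^{-1}\,\mathrm E|\hat\eta-\eta|^2$. Write $\mathrm{ave}(x)=p^{-1}\sum_{i=1}^p x_i$; operations on vectors are componentwise. For $b\in(0,1]$ let $$\mathcal E_M(b)=\{a\in[1,\infty]^p:\ a_i=1\text{ for } i\le bp,\quad 1\le a_{[bp]+1}\le\dots\le a_p\le\infty\},$$ and for $a\in\mathcal E_M(b)$, $r>0$, $\sigma^2>0$ let $E(r,a,\sigma^2)=\{\xi\in\mathbb R^p:\ \mathrm{ave}(a\xi^2)\le\sigma^2 r\}$, where $a_i=\infty$ means that $\xi_i=0$ and $a_i^{-1}=0$. Let $$\xi_0^2=\sigma^2\big[(\gamma/a)^{1/2}-1\big]_+,\qquad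 \gamma>0\ \text{ such that }\ \mathrm{ave}(a\,\xi_0^2)=\sigma^2 r$$ (with $a_i\xi_{0,i}^2=0$ where $a_i=\infty$), and $$\nu_p(r,a,\sigma^2)=\sigma^2\,\mathrm{ave}\big[\xi_0^2/(\sigma^2+\xi_0^2)\big].$$ Given an estimator $\hat\sigma^2=\hat\sigma^2(y)$ of $\sigma^2$, the shrinkage-adaptive MS estimator is $\hat\eta_{\rm MS}=U\,\mathrm{diag}\{\hat f\}\,U'y$, where $\hat f$ minimizes the estimated risk $\mathrm{ave}[f^2\hat\sigma^2+(1-f)^2(z^2-\hat\sigma^2)]$ over all $f\in[0,1]^p$ with $f_1\ge f_2\ge\dots\ge f_p$. **Theorem 3.1.** Fix the bases $U_p$. Let $b\in(0,1]$, $r>0$, $\sigma^2>0$, and let $a=a^{(p)}\in\mathcal E_M(b)$ for every $p$. Then the number $\gamma$ above exists and is unique whenever $bp\ge 1$, and $$\lim_{p\to\infty}\Big[\inf_{\hat\eta}\ \sup_{\xi\in E(r,a,\sigma^2)}R(\hat\eta,\eta,\sigma^2)\Big/\nu_p(r,a,\sigma^2)\Big]=1,$$ the infimum being over all estimators of $\eta$.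 Moreover, if the variance estimator is consistent in the sense that $\lim_{p\to\infty}\sup_{\xi\in E(r,a,\sigma^2)}\mathrm E|\hat\sigma^2-\sigma^2|=0$, then the shrinkage-adaptive MS estimator attains this bound: $$\lim_{p\to\infty}\Big[\sup_{\xi\in E(r,a,\sigma^2)}R(\hat\eta_{\rm MS},\eta,\sigma^2)\Big/\nu_p(r,a,\sigma^2)\Big]=1.$$ -/

import Mathlib

open MeasureTheory ProbabilityTheory Filter Topology
open scoped ENNReal Matrix

namespace MonotoneShrinkage

noncomputable section

/-- The law `N(η, v I_n)` of the observation `y`; `v` is the error variance `σ²`. -/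
def obsLaw {n : ℕ} (η : EuclideanSpace ℝ (Fin n)) (v : ℝ) :
    Measure (EuclideanSpace ℝ (Fin n)) :=
  multivariateGaussian η (v • (1 : Matrix (Fin n) (Fin n) ℝ))

/-- The mean vector `η = U ξ` with canonical coordinates `ξ = Uᵀ η`. -/
def meanOf {n p : ℕ} (U : Matrix (Fin n) (Fin p) ℝ) (ξ : Fin p → ℝ) :
    EuclideanSpace ℝ (Fin n) :=
  WithLp.toLp 2 (U *ᵥ ξ)

/-- The canonical observation `z = Uᵀ y`. -/
def canonicalObs {n p : ℕ} (U : Matrix (Fin n) (Fin p) ℝ)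
    (y : EuclideanSpace ℝ (Fin n)) : Fin p → ℝ :=
  Uᵀ *ᵥ y.ofLp

/-- The normalized quadratic risk `R(δ, η, v) = p⁻¹ E |δ(y) - η|²` for `y ∼ N(η, v I_n)`,
as an extended nonnegative number (`p` is the dimension of the regression space). -/
def risk (p : ℕ) {n : ℕ}
    (δ : EuclideanSpace ℝ (Fin n) → EuclideanSpace ℝ (Fin n))
    (η : EuclideanSpace ℝ (Fin n)) (v : ℝ) : ℝ≥0∞ :=
  (∫⁻ y, ENNReal.ofReal (‖δ y - η‖ ^ 2) ∂(obsLaw η v)) / (p : ℝ≥0∞)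

/-- The set `E_M(b)` of weight vectors: nondecreasing, with values in `[1, ∞]`, and equal to `1`
at the (one-based) positions not exceeding `b p`. -/
def weightClass (b : ℝ) (p : ℕ) : Set (Fin p → ℝ≥0∞) :=
  {a | (∀ i : Fin p, ((i : ℕ) : ℝ) + 1 ≤ b * p → a i = 1) ∧ (∀ i, 1 ≤ a i) ∧ Monotone a}

/-- `ave(a x)` for extended weights `a` and a nonnegative vector `x`. Here `∞ * 0 = 0`, while
`∞ * t = ∞` for `t > 0`. -/
def weightedAve {p : ℕ} (a : Fin p → ℝ≥0∞) (x : Fin p → ℝ) : ℝ≥0∞ :=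
  (∑ i, a i * ENNReal.ofReal (x i)) / (p : ℝ≥0∞)

/-- The ellipsoid `E(r, a, v) = {ξ : ave(a ξ²) ≤ v r}`. The conventions for `∞` force
`ξ i = 0` wherever `a i = ∞`. -/
def ellipsoid {p : ℕ} (r : ℝ) (a : Fin p → ℝ≥0∞) (v : ℝ) : Set (Fin p → ℝ) :=
  {ξ | weightedAve a (fun i => ξ i ^ 2) ≤ ENNReal.ofReal (v * r)}

/-- The vector `ξ₀² = v [(γ / a)^{1/2} - 1]₊`, where `1 / ∞ = 0`. -/
def pinskerSq {p : ℕ} (a : Fin p → ℝ≥0∞) (v γ : ℝ) (i : Fin p) : ℝ :=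
  v * max (Real.sqrt (γ * ((a i)⁻¹).toReal) - 1) 0

/-- `γ > 0` solves `ave(a ξ₀²) = v r`. -/
def IsPinskerLevel {p : ℕ} (r : ℝ) (a : Fin p → ℝ≥0∞) (v γ : ℝ) : Prop :=
  0 < γ ∧ weightedAve a (pinskerSq a v γ) = ENNReal.ofReal (v * r)

open Classical in
/-- The positive number `γ` that solves `ave(a ξ₀²) = v r` (the default value `0` is taken only
if there is no solution). -/
def pinskerLevel {p : ℕ} (r : ℝ) (a : Fin p → ℝ≥0∞) (v : ℝ) : ℝ :=
  if h : ∃ γ, IsPinskerLevel r a v γ then h.choose else 0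

/-- `ν_p(r, a, v) = v ave[ξ₀² / (v + ξ₀²)]`. -/
def pinskerValue {p : ℕ} (r : ℝ) (a : Fin p → ℝ≥0∞) (v : ℝ) : ℝ :=
  v * ((∑ i, pinskerSq a v (pinskerLevel r a v) i /
    (v + pinskerSq a v (pinskerLevel r a v) i)) / p)

/-- The minimax normalized quadratic risk over the ellipsoid, the infimum being over all
(measurable) estimators of `η`. -/
def minimaxRisk {n p : ℕ} (U : Matrix (Fin n) (Fin p) ℝ) (r : ℝ) (a : Fin p → ℝ≥0∞)
    (v : ℝ) : ℝ≥0∞ :=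
  ⨅ (δ : EuclideanSpace ℝ (Fin n) → EuclideanSpace ℝ (Fin n)) (_ : Measurable δ),
    ⨆ ξ ∈ ellipsoid r a v, risk p δ (meanOf U ξ) v

/-- The monotone shrinkage class `F_MS`. -/
def monotoneClass (p : ℕ) : Set (Fin p → ℝ) :=
  {f | (∀ i, f i ∈ Set.Icc (0 : ℝ) 1) ∧ Antitone f}

/-- The estimated risk `ave[f² s + (1 - f)² (z² - s)]` of the shrinkage vector `f`, where `s` is
the estimated variance. -/
def estimatedRisk {p : ℕ} (z : Fin p → ℝ) (s : ℝ) (f : Fin p → ℝ) : ℝ :=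
  (∑ i, (f i ^ 2 * s + (1 - f i) ^ 2 * (z i ^ 2 - s))) / p

/-- `f̂` is a shrinkage-adaptive choice based on the variance estimator `σ̂² = s`: for all data `y`
it minimizes the estimated risk over the monotone shrinkage class. -/
def IsAdaptiveShrinkage {n p : ℕ} (U : Matrix (Fin n) (Fin p) ℝ)
    (s : EuclideanSpace ℝ (Fin n) → ℝ)
    (fhat : EuclideanSpace ℝ (Fin n) → Fin p → ℝ) : Prop :=
  ∀ y, fhat y ∈ monotoneClass p ∧
    ∀ f ∈ monotoneClass p,
      estimatedRisk (canonicalObs U y) (s y) (fhat y) ≤ estimatedRisk (canonicalObs U y) (s y) f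

/-- The MS estimator `U diag(f̂) Uᵀ y` with the (possibly data-dependent) shrinkage vector `f̂`. -/
def msEstimator {n p : ℕ} (U : Matrix (Fin n) (Fin p) ℝ)
    (fhat : EuclideanSpace ℝ (Fin n) → Fin p → ℝ)
    (y : EuclideanSpace ℝ (Fin n)) : EuclideanSpace ℝ (Fin n) :=
  meanOf U (fun i => fhat y i * canonicalObs U y i)

/-- The mean absolute error `E |σ̂² - v|` of a variance estimator when `y ∼ N(η, v I_n)`. -/
def varianceError {n : ℕ} (s : EuclideanSpace ℝ (Fin n) → ℝ)
    (η : EuclideanSpace ℝ (Fin n)) (v : ℝ) : ℝ≥0∞ :=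
  ∫⁻ y, ENNReal.ofReal |s y - v| ∂(obsLaw η v)

end

end MonotoneShrinkage

/-! The canonical observation `z = Uᵀ y` has independent Gaussian coordinates with means `ξ i` and
variance `v`, so everything reduces to this sequence model. Write `m = ξ₀² / v` and `f = m / (1 +
m)`.

Upper bound. The Pinsker filter satisfies `(1 - f)² ≤ a / γ`, with equality where `m > 0`. The bias
term on the ellipsoid is therefore at most `v r / γ`, and the risk of this linear rule is at most
`ν_p` for each `p` with `b p ≥ 1`, with no remainder (`pinskerFilter_risk_le`).

Lower bound. Take a Gaussian prior with variances `(1 - ε) ξ₀²`. Its Bayes risk is at least `(1 - ε)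
ν_p` (`bayesRisk_le`), while `ave(a ξ²)` concentrates strictly inside the ellipsoid. The unit
weights in the first `b p` positions bound `γ`, hence `a ξ₀²`, uniformly in `p`. The part of the
prior outside the ellipsoid thus costs only `O(1 / p)` (`bayes_le_iSup_risk`), which is negligible
because `ν_p` stays away from `0` (`le_pinskerValue`).

Adaptation. Since `a` is nondecreasing, the Pinsker filter belongs to the monotone class. Up to a
term free of `f`, loss and estimated risk differ by linear functionals of `f`: the noise sum `∑ f w`
with `w = z (z - ξ) - v`, and one of size `p |σ̂² - v|`. For monotone `f`, Abel summation bounds the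
first by the maximal partial sum of `w`, which Doob's inequality shows to be `O(√p)`
(`IsRiskMinimizer.loss_le`, `integral_runMax_sq_le`). So the adaptive rule loses only `o(1)` against
Pinsker's. The minimax lower bound applies to it because it coincides almost surely with a
measurable estimator (`minimaxRisk_le_msEstimator`). -/

namespace MonotoneShrinkage

noncomputable section

/-! ### Existence and uniqueness of the Pinsker level. -/

/-- The normalized Pinsker variances `ξ₀² / v`. -/
def pinskerUnit {p : ℕ} (a : Fin p → ℝ≥0∞) (γ : ℝ) (i : Fin p) : ℝ :=
  max (Real.sqrt (γ * ((a i)⁻¹).toReal) - 1) 0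

/-- The Pinsker shrinkage factors `ξ₀² / (v + ξ₀²)`. -/
def pinskerFilter {p : ℕ} (a : Fin p → ℝ≥0∞) (γ : ℝ) (i : Fin p) : ℝ :=
  pinskerUnit a γ i / (1 + pinskerUnit a γ i)

/-- The normalized constraint sum `∑ a ξ₀² / v`. -/
def pinskerSum {p : ℕ} (a : Fin p → ℝ≥0∞) (γ : ℝ) : ℝ :=
  ∑ i, (a i).toReal * pinskerUnit a γ i

lemma pinskerUnit_nonneg {p : ℕ} (a : Fin p → ℝ≥0∞) (γ : ℝ) (i : Fin p) :
    0 ≤ pinskerUnit a γ i := le_max_right _ _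

lemma pinskerSq_eq {p : ℕ} (a : Fin p → ℝ≥0∞) (v γ : ℝ) (i : Fin p) :
    pinskerSq a v γ i = v * pinskerUnit a γ i := rfl

lemma pinskerUnit_of_top {p : ℕ} {a : Fin p → ℝ≥0∞} {i : Fin p} (h : a i = ∞) (γ : ℝ) :
    pinskerUnit a γ i = 0 := by
  simp [pinskerUnit, h]

lemma weight_mul_ofReal {x : ℝ≥0∞} {y : ℝ} (h : x = ∞ → y = 0) :
    x * ENNReal.ofReal y = ENNReal.ofReal (x.toReal * y) := by
  by_cases hx : x = ∞
  · simp [h hx]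
  · rw [ENNReal.ofReal_mul ENNReal.toReal_nonneg, ENNReal.ofReal_toReal hx]

lemma weightedAve_eq_ofReal {p : ℕ} (hp : 0 < p) {a : Fin p → ℝ≥0∞} {x : Fin p → ℝ}
    (hx : ∀ i, 0 ≤ x i) (h : ∀ i, a i = ∞ → x i = 0) :
    weightedAve a x = ENNReal.ofReal ((∑ i, (a i).toReal * x i) / p) := by
  rw [weightedAve, ENNReal.ofReal_div_of_pos (by exact_mod_cast hp), ENNReal.ofReal_natCast,
    ENNReal.ofReal_sum_of_nonneg fun i _ => mul_nonneg ENNReal.toReal_nonneg (hx i)]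
  congr 1
  exact Finset.sum_congr rfl fun i _ => weight_mul_ofReal (h i)

/-- Both sides are proportional to `v`, and infinite weights meet a vanishing variance, so the level
solves a real equation free of `v`. -/
lemma isPinskerLevel_iff {p : ℕ} (hp : 0 < p) {a : Fin p → ℝ≥0∞} {r v γ : ℝ} (hr : 0 < r)
    (hv : 0 < v) : IsPinskerLevel r a v γ ↔ 0 < γ ∧ pinskerSum a γ = p * r := by
  have hp' : (0 : ℝ) < p := by exact_mod_cast hp
  have hs : (∑ i, (a i).toReal * pinskerSq a v γ i) = v * pinskerSum a γ := by
    rw [pinskerSum, Finset.mul_sum]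
    exact Finset.sum_congr rfl fun i _ => by rw [pinskerSq_eq]; ring
  rw [IsPinskerLevel, weightedAve_eq_ofReal (x := pinskerSq a v γ) hp
    (fun i => mul_nonneg hv.le (pinskerUnit_nonneg a γ i))
    (fun i hi => by rw [pinskerSq_eq, pinskerUnit_of_top hi, mul_zero]), hs,
    ENNReal.ofReal_eq_ofReal_iff]
  · refine and_congr_right fun _ => ?_
    rw [div_eq_iff hp'.ne', mul_assoc, mul_right_inj' hv.ne', mul_comm r]
  · exact div_nonneg (mul_nonneg hv.le (Finset.sum_nonneg fun i _ =>
      mul_nonneg ENNReal.toReal_nonneg (pinskerUnit_nonneg a γ i))) hp'.le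
  · positivity

lemma inv_toReal_le_one {x : ℝ≥0∞} (h : 1 ≤ x) : (x⁻¹).toReal ≤ 1 := by
  have := ENNReal.toReal_mono ENNReal.one_ne_top (ENNReal.inv_le_one.2 h)
  simpa using this

lemma pinskerUnit_mono {p : ℕ} (a : Fin p → ℝ≥0∞) (i : Fin p) :
    Monotone fun γ => pinskerUnit a γ i := by
  intro γ γ' h
  have : γ * ((a i)⁻¹).toReal ≤ γ' * ((a i)⁻¹).toReal :=
    mul_le_mul_of_nonneg_right h ENNReal.toReal_nonneg
  exact max_le_max (sub_le_sub_right (Real.sqrt_le_sqrt this) _) le_rfl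

lemma pinskerUnit_eq_zero {p : ℕ} {a : Fin p → ℝ≥0∞} {i : Fin p} (ha : 1 ≤ a i) {γ : ℝ}
    (hγ : γ ≤ 1) : pinskerUnit a γ i = 0 := by
  refine max_eq_right ?_
  have h0 : (0 : ℝ) ≤ ((a i)⁻¹).toReal := ENNReal.toReal_nonneg
  have h1 := inv_toReal_le_one ha
  have : Real.sqrt (γ * ((a i)⁻¹).toReal) ≤ 1 := by
    rw [Real.sqrt_le_one]
    nlinarith
  linarith

lemma pinskerUnit_of_one {p : ℕ} {a : Fin p → ℝ≥0∞} {i : Fin p} (ha : a i = 1) (γ : ℝ) :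
    pinskerUnit a γ i = max (Real.sqrt γ - 1) 0 := by
  simp [pinskerUnit, ha]

lemma continuous_pinskerSum {p : ℕ} (a : Fin p → ℝ≥0∞) : Continuous (pinskerSum a) := by
  unfold pinskerSum pinskerUnit
  fun_prop

lemma pinskerSum_lt {p : ℕ} {a : Fin p → ℝ≥0∞} {i₀ : Fin p} (h₀ : a i₀ = 1) {γ γ' : ℝ}
    (h : γ < γ') (h' : 1 < γ') : pinskerSum a γ < pinskerSum a γ' := by
  refine Finset.sum_lt_sum (fun i _ => mul_le_mul_of_nonneg_left (pinskerUnit_mono a i h.le)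
    ENNReal.toReal_nonneg) ⟨i₀, Finset.mem_univ _, ?_⟩
  rw [pinskerUnit_of_one h₀, pinskerUnit_of_one h₀, h₀]
  simp only [ENNReal.toReal_one, one_mul]
  have h1 : 1 < Real.sqrt γ' := by rw [Real.lt_sqrt (by norm_num)]; simpa using h'
  have h2 : Real.sqrt γ < Real.sqrt γ' := Real.sqrt_lt_sqrt_iff_of_pos (by linarith) |>.2 h
  rw [max_eq_left (by linarith : 0 ≤ Real.sqrt γ' - 1)]
  exact max_lt (by linarith) (by linarith)

lemma pinskerSum_eq_zero {p : ℕ} {a : Fin p → ℝ≥0∞} (ha : ∀ i, 1 ≤ a i) {γ : ℝ} (hγ : γ ≤ 1) :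
    pinskerSum a γ = 0 :=
  Finset.sum_eq_zero fun i _ => by rw [pinskerUnit_eq_zero (ha i) hγ, mul_zero]

/-- Intermediate values between `γ = 1`, where the sum vanishes because all weights are at least
`1`, and `γ = (1 + p r)²`, where the unit-weight coordinate alone contributes `p r`. That same
coordinate makes the sum strictly increasing beyond `1`. -/
theorem existsUnique_isPinskerLevel {p : ℕ} {a : Fin p → ℝ≥0∞} (ha : ∀ i, 1 ≤ a i)
    {i₀ : Fin p} (h₀ : a i₀ = 1) {r v : ℝ} (hr : 0 < r) (hv : 0 < v) :
    ∃! γ : ℝ, IsPinskerLevel r a v γ := by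
  have hp : 0 < p := i₀.pos
  have hp' : (0 : ℝ) < p := by exact_mod_cast hp
  simp_rw [isPinskerLevel_iff hp hr hv]
  have hpr : 0 < p * r := by positivity
  have hbig : p * r ≤ pinskerSum a ((1 + p * r) ^ 2) := by
    have : (a i₀).toReal * pinskerUnit a ((1 + p * r) ^ 2) i₀ ≤ pinskerSum a ((1 + p * r) ^ 2) :=
      Finset.single_le_sum (f := fun i => (a i).toReal * pinskerUnit a ((1 + p * r) ^ 2) i)
        (fun i _ => mul_nonneg ENNReal.toReal_nonneg (pinskerUnit_nonneg a _ i))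
        (Finset.mem_univ i₀)
    rw [pinskerUnit_of_one h₀, h₀, Real.sqrt_sq (by linarith)] at this
    simpa [hpr.le] using this
  have hle : (1 : ℝ) ≤ (1 + p * r) ^ 2 := by nlinarith
  obtain ⟨γ, hγ, hγ'⟩ := intermediate_value_Icc hle (continuous_pinskerSum a).continuousOn
    (show p * r ∈ Set.Icc (pinskerSum a 1) (pinskerSum a ((1 + p * r) ^ 2)) from
      ⟨by rw [pinskerSum_eq_zero ha le_rfl]; exact hpr.le, hbig⟩)
  have key : ∀ {x}, pinskerSum a x = p * r → 1 < x := fun {x} hx => by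
    by_contra! h
    rw [pinskerSum_eq_zero ha h] at hx
    linarith
  refine ⟨γ, ⟨by linarith [hγ.1], hγ'⟩, ?_⟩
  rintro γ₂ ⟨-, h₂⟩
  rcases lt_trichotomy γ₂ γ with h | h | h
  · have := pinskerSum_lt h₀ h (key hγ')
    linarith
  · exact h
  · have := pinskerSum_lt h₀ h (key h₂)
    linarith

lemma isPinskerLevel_pinskerLevel {p : ℕ} {a : Fin p → ℝ≥0∞} {r v : ℝ}
    (h : ∃ γ, IsPinskerLevel r a v γ) : IsPinskerLevel r a v (pinskerLevel r a v) := by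
  rw [pinskerLevel, dif_pos h]
  exact h.choose_spec

lemma exists_weight_eq_one {b : ℝ} {p : ℕ} (h : 1 ≤ b * p) {a : Fin p → ℝ≥0∞}
    (ha : a ∈ weightClass b p) : ∃ i₀ : Fin p, a i₀ = 1 := by
  have hp : 0 < p := by
    rcases Nat.eq_zero_or_pos p with rfl | h'
    · norm_num at h
    · exact h'
  exact ⟨⟨0, hp⟩, ha.1 _ (by simpa using h)⟩

/-! ### The Pinsker filter and its risk on the ellipsoid. -/

lemma pinskerFilter_nonneg {p : ℕ} (a : Fin p → ℝ≥0∞) (γ : ℝ) (i : Fin p) :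
    0 ≤ pinskerFilter a γ i := by
  have := pinskerUnit_nonneg a γ i
  unfold pinskerFilter
  positivity

lemma pinskerFilter_le_one {p : ℕ} (a : Fin p → ℝ≥0∞) (γ : ℝ) (i : Fin p) :
    pinskerFilter a γ i ≤ 1 := by
  have := pinskerUnit_nonneg a γ i
  unfold pinskerFilter
  rw [div_le_one (by linarith)]
  linarith

/-- This makes the Pinsker filter an admissible competitor for the adaptive choice. -/
lemma pinskerFilter_mem_monotoneClass {p : ℕ} {a : Fin p → ℝ≥0∞} (ha : ∀ i, 1 ≤ a i)
    (hm : Monotone a) {γ : ℝ} (hγ : 0 < γ) : pinskerFilter a γ ∈ monotoneClass p := by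
  refine ⟨fun i => ⟨pinskerFilter_nonneg a γ i, pinskerFilter_le_one a γ i⟩, fun i j hij => ?_⟩
  have h1 : pinskerUnit a γ j ≤ pinskerUnit a γ i := by
    refine max_le_max (sub_le_sub_right (Real.sqrt_le_sqrt ?_) _) le_rfl
    refine mul_le_mul_of_nonneg_left (ENNReal.toReal_mono ?_ (ENNReal.inv_le_inv.2 (hm hij))) hγ.le
    exact ENNReal.inv_ne_top.2 (zero_lt_one.trans_le (ha i)).ne'
  have h2 := pinskerUnit_nonneg a γ j
  unfold pinskerFilter
  rw [div_le_div_iff₀ (by linarith) (by linarith)]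
  nlinarith

/-- Where the Pinsker variance is positive, `a (1 + ξ₀² / v)² = γ`. -/
lemma weight_mul_sq {p : ℕ} {a : Fin p → ℝ≥0∞} (ha : ∀ i, 1 ≤ a i) {γ : ℝ} (hγ : 0 < γ)
    (i : Fin p) (h : pinskerUnit a γ i ≠ 0) :
    (a i).toReal * (1 + pinskerUnit a γ i) ^ 2 = γ := by
  have hfin : a i ≠ ∞ := fun hi => h (pinskerUnit_of_top hi γ)
  have hpos : 0 < (a i).toReal :=
    ENNReal.toReal_pos (zero_lt_one.trans_le (ha i)).ne' hfin
  have : 1 + pinskerUnit a γ i = Real.sqrt (γ * ((a i)⁻¹).toReal) := by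
    unfold pinskerUnit at h ⊢
    rw [max_eq_left]
    · ring
    · by_contra! h'
      exact h (max_eq_right h'.le)
  rw [this, Real.sq_sqrt (mul_nonneg hγ.le ENNReal.toReal_nonneg), ENNReal.toReal_inv]
  field_simp

/-- `1 - f = 1 / (1 + m)` and `1 + m ≥ √(γ / a)`, also where the positive part is cut off. This
prices the squared bias at `a ξ² / γ`. -/
lemma sq_one_sub_pinskerFilter_le {p : ℕ} {a : Fin p → ℝ≥0∞} (ha : ∀ i, 1 ≤ a i) {γ : ℝ}
    (hγ : 0 < γ) (i : Fin p) (hi : a i ≠ ∞) :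
    (1 - pinskerFilter a γ i) ^ 2 ≤ (a i).toReal / γ := by
  have hpos : 0 < (a i).toReal :=
    ENNReal.toReal_pos (zero_lt_one.trans_le (ha i)).ne' hi
  have h0 := pinskerUnit_nonneg a γ i
  have h1 : 1 - pinskerFilter a γ i = 1 / (1 + pinskerUnit a γ i) := by
    unfold pinskerFilter; field_simp; ring
  rw [h1, div_pow, one_pow, div_le_div_iff₀ (by positivity) hγ, one_mul]
  have h2 : Real.sqrt (γ * ((a i)⁻¹).toReal) ≤ 1 + pinskerUnit a γ i := by
    have := le_max_left (Real.sqrt (γ * ((a i)⁻¹).toReal) - 1) 0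
    unfold pinskerUnit; linarith
  have h3 := Real.sqrt_le_left (by linarith) |>.1 h2
  rw [ENNReal.toReal_inv, ← div_eq_mul_inv, div_le_iff₀ hpos] at h3
  linarith

/-- Where `m > 0`, `a / γ = 1 / (1 + m)²`, so the left side is `(m² + m) / (1 + m)²`. It turns
variance plus priced bias into the summand of `ν_p`. -/
lemma pinskerFilter_sq_add {p : ℕ} {a : Fin p → ℝ≥0∞} (ha : ∀ i, 1 ≤ a i) {γ : ℝ}
    (hγ : 0 < γ) (i : Fin p) :
    pinskerFilter a γ i ^ 2 + (a i).toReal * pinskerUnit a γ i / γ = pinskerFilter a γ i := by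
  have h0 := pinskerUnit_nonneg a γ i
  by_cases h : pinskerUnit a γ i = 0
  · simp [pinskerFilter, h]
  · have h1 := weight_mul_sq ha hγ i h
    have h2 : (a i).toReal / γ = 1 / (1 + pinskerUnit a γ i) ^ 2 := by
      rw [div_eq_div_iff hγ.ne' (by positivity)]; linarith
    rw [mul_div_right_comm, h2]
    unfold pinskerFilter
    field_simp
    ring

lemma pinskerValue_eq {p : ℕ} (r : ℝ) (a : Fin p → ℝ≥0∞) {v : ℝ} (hv : 0 < v) :
    pinskerValue r a v = v * ((∑ i, pinskerFilter a (pinskerLevel r a v) i) / p) := by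
  unfold pinskerValue
  congr 2
  refine Finset.sum_congr rfl fun i _ => ?_
  have h0 := pinskerUnit_nonneg a (pinskerLevel r a v) i
  rw [pinskerSq_eq, pinskerFilter]
  field_simp

lemma sum_le_of_mem_ellipsoid {p : ℕ} (hp : 0 < p) {a : Fin p → ℝ≥0∞} {r v : ℝ} (hr : 0 < r)
    (hv : 0 < v) {ξ : Fin p → ℝ} (hξ : ξ ∈ ellipsoid r a v) :
    (∀ i, a i = ∞ → ξ i = 0) ∧ ∑ i, (a i).toReal * ξ i ^ 2 ≤ p * (v * r) := by
  have hp' : (0 : ℝ) < p := by exact_mod_cast hp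
  have htop : ∀ i, a i = ∞ → ξ i = 0 := by
    intro i hi
    by_contra h
    have h1 : a i * ENNReal.ofReal (ξ i ^ 2) = ∞ := by
      rw [hi, ENNReal.top_mul]
      simpa using h
    have h2 : weightedAve a (fun i => ξ i ^ 2) = ∞ := by
      rw [weightedAve, ENNReal.sum_eq_top.2 ⟨i, Finset.mem_univ _, h1⟩,
        ENNReal.top_div_of_ne_top (by simp)]
    have h3 : weightedAve a (fun i => ξ i ^ 2) ≤ ENNReal.ofReal (v * r) := hξ
    rw [h2] at h3
    simp at h3
  refine ⟨htop, ?_⟩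
  have h3 : weightedAve a (fun i => ξ i ^ 2) ≤ ENNReal.ofReal (v * r) := hξ
  rw [weightedAve_eq_ofReal hp (fun i => sq_nonneg _) (fun i hi => by simp [htop i hi]),
    ENNReal.ofReal_le_ofReal_iff (by positivity), div_le_iff₀ hp'] at h3
  linarith

lemma mem_ellipsoid_of_sum_le {p : ℕ} (hp : 0 < p) {a : Fin p → ℝ≥0∞} {r v : ℝ}
    {ξ : Fin p → ℝ} (h0 : ∀ i, a i = ∞ → ξ i = 0)
    (h : (∑ i, (a i).toReal * ξ i ^ 2) / p ≤ v * r) : ξ ∈ ellipsoid r a v := by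
  change weightedAve a (fun i => ξ i ^ 2) ≤ ENNReal.ofReal (v * r)
  rw [weightedAve_eq_ofReal hp (fun i => sq_nonneg _) (fun i hi => by simp [h0 i hi])]
  exact ENNReal.ofReal_le_ofReal h

lemma sum_sq_le_of_mem_ellipsoid {p : ℕ} (hp : 0 < p) {a : Fin p → ℝ≥0∞} (ha : ∀ i, 1 ≤ a i)
    {r v : ℝ} (hr : 0 < r) (hv : 0 < v) {ξ : Fin p → ℝ} (hξ : ξ ∈ ellipsoid r a v) :
    ∑ i, ξ i ^ 2 ≤ p * (v * r) := by
  obtain ⟨h0, h1⟩ := sum_le_of_mem_ellipsoid hp hr hv hξ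
  refine (Finset.sum_le_sum fun i _ => ?_).trans h1
  by_cases hi : a i = ∞
  · simp [h0 i hi]
  · have : (1 : ℝ) ≤ (a i).toReal := by
      have := ENNReal.toReal_mono hi (ha i)
      simpa using this
    nlinarith [sq_nonneg (ξ i)]

/-- The risk of the Pinsker filter is at most the Pinsker value over the ellipsoid. -/
lemma pinskerFilter_risk_le {p : ℕ} (hp : 0 < p) {a : Fin p → ℝ≥0∞} (ha : ∀ i, 1 ≤ a i)
    {r v : ℝ} (hr : 0 < r) (hv : 0 < v) (hex : ∃ γ, IsPinskerLevel r a v γ)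
    {ξ : Fin p → ℝ} (hξ : ξ ∈ ellipsoid r a v) :
    (∑ i, (pinskerFilter a (pinskerLevel r a v) i ^ 2 * v +
      (1 - pinskerFilter a (pinskerLevel r a v) i) ^ 2 * ξ i ^ 2)) / p ≤ pinskerValue r a v := by
  obtain ⟨hγ, hs⟩ := (isPinskerLevel_iff hp hr hv).1 (isPinskerLevel_pinskerLevel hex)
  rw [pinskerValue_eq r a hv]
  set γ := pinskerLevel r a v
  have hp' : (0 : ℝ) < p := by exact_mod_cast hp
  obtain ⟨h0, h1⟩ := sum_le_of_mem_ellipsoid hp hr hv hξ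
  rw [← mul_div_assoc]
  refine div_le_div_of_nonneg_right ?_ hp'.le
  calc ∑ i, (pinskerFilter a γ i ^ 2 * v + (1 - pinskerFilter a γ i) ^ 2 * ξ i ^ 2)
      ≤ ∑ i, (v * pinskerFilter a γ i ^ 2 + ((a i).toReal * ξ i ^ 2) / γ) := by
        refine Finset.sum_le_sum fun i _ => ?_
        by_cases hi : a i = ∞
        · simp [h0 i hi, mul_comm]
        · have := mul_le_mul_of_nonneg_right (sq_one_sub_pinskerFilter_le ha hγ i hi)
            (sq_nonneg (ξ i))
          rw [div_mul_eq_mul_div] at this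
          linarith
    _ = v * ∑ i, pinskerFilter a γ i ^ 2 + (∑ i, (a i).toReal * ξ i ^ 2) / γ := by
        rw [Finset.sum_add_distrib, Finset.mul_sum, Finset.sum_div]
    -- The budget `p v r` of the ellipsoid is exactly what the Pinsker variances spend.
    _ ≤ v * ∑ i, pinskerFilter a γ i ^ 2 + v * (∑ i, (a i).toReal * pinskerUnit a γ i / γ) := by
        refine add_le_add_right ?_ _
        rw [← Finset.sum_div, ← mul_div_assoc]
        refine div_le_div_of_nonneg_right ?_ hγ.le
        have : (∑ i, (a i).toReal * pinskerUnit a γ i) = p * r := hs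
        rw [this]; linarith
    _ = v * ∑ i, pinskerFilter a γ i := by
        rw [← mul_add, ← Finset.sum_add_distrib]
        simp_rw [pinskerFilter_sq_add ha hγ]

/-! ### Bounds on the level and on the value, uniform in the dimension. -/

lemma one_lt_of_pinskerSum_pos {p : ℕ} {a : Fin p → ℝ≥0∞} (ha : ∀ i, 1 ≤ a i) {γ : ℝ}
    (h : 0 < pinskerSum a γ) : 1 < γ := by
  by_contra! h'
  rw [pinskerSum_eq_zero ha h'] at h
  exact lt_irrefl _ h

/-- Where `m > 0`, `a m = γ m / (1 + m)²` with `1 ≤ 1 + m ≤ √γ`; use `m / (1 + m) ≤ (√γ - 1) / √γ`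
and drop the other factor. The bound serves both to control the prior and to keep `γ` away from `1`.
-/
lemma weight_mul_pinskerUnit_le {p : ℕ} {a : Fin p → ℝ≥0∞} (ha : ∀ i, 1 ≤ a i) {γ : ℝ}
    (hγ : 1 < γ) (i : Fin p) :
    (a i).toReal * pinskerUnit a γ i ≤ Real.sqrt γ * (Real.sqrt γ - 1) := by
  have h0 := pinskerUnit_nonneg a γ i
  have hg : 1 < Real.sqrt γ := by rw [Real.lt_sqrt (by norm_num)]; simpa using hγ
  by_cases h : pinskerUnit a γ i = 0
  · rw [h, mul_zero]; nlinarith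
  have h1 := weight_mul_sq ha (by linarith) i h
  have hsq : Real.sqrt γ ^ 2 = γ := Real.sq_sqrt (by linarith)
  have hfin : a i ≠ ∞ := fun hi => h (pinskerUnit_of_top hi γ)
  have h2 : (1 : ℝ) ≤ (a i).toReal := by
    have := ENNReal.toReal_mono hfin (ha i)
    simpa using this
  generalize Real.sqrt γ = g at *
  generalize pinskerUnit a γ i = m at *
  generalize (a i).toReal = c at *
  have h3 : 1 + m ≤ g := by nlinarith
  have h4 : g * m ≤ (g - 1) * (1 + m) := by nlinarith
  have h5 : c * (1 + m) ≤ g ^ 2 := by nlinarith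
  have h6 : g * (c * m) ≤ g * (g * (g - 1)) := by
    calc g * (c * m) = c * (g * m) := by ring
      _ ≤ c * ((g - 1) * (1 + m)) := mul_le_mul_of_nonneg_left h4 (by linarith)
      _ = (g - 1) * (c * (1 + m)) := by ring
      _ ≤ (g - 1) * g ^ 2 := mul_le_mul_of_nonneg_left h5 (by linarith)
      _ = _ := by ring
  exact le_of_mul_le_mul_left h6 (by linarith)

/-- The count is `⌊b p⌋`, and `b p < ⌊b p⌋ + 1 ≤ 2 ⌊b p⌋` once `b p ≥ 1`. -/
lemma card_unit_weights {b : ℝ} {p : ℕ} (hb1 : b ≤ 1) (h : 1 ≤ b * p) :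
    b * p / 2 ≤ ((Finset.univ.filter fun i : Fin p => ((i : ℕ) : ℝ) + 1 ≤ b * p).card : ℝ) := by
  have hle : ⌊b * p⌋₊ ≤ p := by
    refine Nat.floor_le_of_le ?_
    nlinarith [(Nat.cast_nonneg p : (0 : ℝ) ≤ p)]
  have hcard : (Finset.univ.filter fun i : Fin p => ((i : ℕ) : ℝ) + 1 ≤ b * p).card = ⌊b * p⌋₊ := by
    have : (Finset.univ.filter fun i : Fin p => ((i : ℕ) : ℝ) + 1 ≤ b * p) =
        Finset.univ.filter fun i : Fin p => (i : ℕ) < ⌊b * p⌋₊ := by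
      ext i
      simp only [Finset.mem_filter, Finset.mem_univ, true_and]
      rw [← Nat.succ_le_iff, Nat.le_floor_iff (by linarith)]
      push_cast
      rfl
    rw [this, Fin.card_filter_val_lt, min_eq_right hle]
  rw [hcard]
  have h1 : (1 : ℝ) ≤ ⌊b * p⌋₊ := by exact_mod_cast Nat.le_floor (by simpa using h)
  have h2 := Nat.lt_floor_add_one (b * p)
  linarith

/-- At least `b p / 2` coordinates have unit weight and contribute `√γ - 1` each to a total of `p
r`. Thus `b > 0` keeps the level bounded as `p` grows. -/
lemma sqrt_level_le {b : ℝ} {p : ℕ} (hb0 : 0 < b) (hb1 : b ≤ 1) (h : 1 ≤ b * p)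
    {a : Fin p → ℝ≥0∞} (ha : a ∈ weightClass b p) {r γ : ℝ} (hγ : 1 < γ)
    (hs : pinskerSum a γ = p * r) : Real.sqrt γ ≤ 1 + 2 * r / b := by
  have hg : 1 < Real.sqrt γ := by rw [Real.lt_sqrt (by norm_num)]; simpa using hγ
  have hc := card_unit_weights hb1 h
  have hp : (0 : ℝ) < p := by
    by_contra! h'
    nlinarith
  have h1 : ((Finset.univ.filter fun i : Fin p => ((i : ℕ) : ℝ) + 1 ≤ b * p).card : ℝ) *
      (Real.sqrt γ - 1) ≤ pinskerSum a γ := by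
    rw [← nsmul_eq_mul, ← Finset.sum_const]
    calc _ = ∑ i ∈ Finset.univ.filter fun i : Fin p => ((i : ℕ) : ℝ) + 1 ≤ b * p,
          (a i).toReal * pinskerUnit a γ i := by
          refine Finset.sum_congr rfl fun i hi => ?_
          have h1 := ha.1 i (Finset.mem_filter.1 hi).2
          rw [pinskerUnit_of_one h1, h1, max_eq_left (by linarith)]
          simp
      _ ≤ _ := Finset.sum_le_sum_of_subset_of_nonneg (Finset.filter_subset _ _)
          fun i _ _ => mul_nonneg ENNReal.toReal_nonneg (pinskerUnit_nonneg a γ i)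
  have h2 : b * p / 2 * (Real.sqrt γ - 1) ≤ p * r := by nlinarith
  have h3 : b * (Real.sqrt γ - 1) ≤ 2 * r := by
    refine le_of_mul_le_mul_left ?_ hp
    linarith
  have h4 : Real.sqrt γ - 1 ≤ 2 * r / b := by
    rw [le_div_iff₀ hb0]; linarith
  linarith

lemma weight_mul_pinskerUnit_le_const {b : ℝ} {p : ℕ} (hb0 : 0 < b) (hb1 : b ≤ 1)
    (h : 1 ≤ b * p) {a : Fin p → ℝ≥0∞} (ha : a ∈ weightClass b p) {r γ : ℝ} (hγ : 1 < γ)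
    (hs : pinskerSum a γ = p * r) (i : Fin p) :
    (a i).toReal * pinskerUnit a γ i ≤ (1 + 2 * r / b) ^ 2 := by
  have h1 := weight_mul_pinskerUnit_le ha.2.1 hγ i
  have h2 := sqrt_level_le hb0 hb1 h ha hγ hs
  have hg := Real.sqrt_nonneg γ
  nlinarith

/-- The Pinsker values are bounded away from zero. -/
lemma le_pinskerValue {b : ℝ} {p : ℕ} (hb1 : b ≤ 1) (h : 1 ≤ b * p)
    {a : Fin p → ℝ≥0∞} (ha : a ∈ weightClass b p) {r v : ℝ} (hr : 0 < r) (hv : 0 < v) :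
    v * b * min 1 (r / 2) / 4 ≤ pinskerValue r a v := by
  have hp : (0 : ℝ) < p := by
    rcases Nat.eq_zero_or_pos p with rfl | h'
    · norm_num at h
    · exact_mod_cast h'
  have hb0 : 0 < b := by
    by_contra! h'
    nlinarith
  obtain ⟨i₀, h₀⟩ := exists_weight_eq_one h ha
  obtain ⟨-, hs⟩ := (isPinskerLevel_iff i₀.pos hr hv).1
    (isPinskerLevel_pinskerLevel (existsUnique_isPinskerLevel ha.2.1 h₀ hr hv).exists)
  rw [pinskerValue_eq r a hv]
  set γ := pinskerLevel r a v
  have hγ : 1 < γ := one_lt_of_pinskerSum_pos ha.2.1 (by rw [hs]; positivity)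
  have hg : 1 < Real.sqrt γ := by rw [Real.lt_sqrt (by norm_num)]; simpa using hγ
  -- `r` is the average of the `a m`, hence at most their common bound.
  have hrg : r ≤ Real.sqrt γ * (Real.sqrt γ - 1) := by
    have : pinskerSum a γ ≤ p * (Real.sqrt γ * (Real.sqrt γ - 1)) := by
      have := Finset.sum_le_card_nsmul Finset.univ (fun i => (a i).toReal * pinskerUnit a γ i) _
        fun i _ => weight_mul_pinskerUnit_le ha.2.1 hγ i
      simpa [pinskerSum] using this
    rw [hs] at this
    exact le_of_mul_le_mul_left this hp
  -- Otherwise `√γ < 2` and `√γ - 1 < r / 2`, so the product in `hrg` would be below `r`.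
  have ht : min 1 (r / 2) ≤ Real.sqrt γ - 1 := by
    by_contra! h'
    have h1 := h'.trans_le (min_le_left _ _)
    have h2 := h'.trans_le (min_le_right _ _)
    nlinarith
  have ht1 : min 1 (r / 2) ≤ 1 := min_le_left _ _
  have ht0 : 0 < min 1 (r / 2) := lt_min one_pos (by linarith)
  set t := min 1 (r / 2)
  have hf : t / 2 ≤ (Real.sqrt γ - 1) / Real.sqrt γ := by
    rw [div_le_div_iff₀ (by norm_num) (by linarith)]
    nlinarith
  have h1 : ((Finset.univ.filter fun i : Fin p => ((i : ℕ) : ℝ) + 1 ≤ b * p).card : ℝ) *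
      (t / 2) ≤ ∑ i, pinskerFilter a γ i := by
    rw [← nsmul_eq_mul, ← Finset.sum_const]
    calc _ ≤ ∑ i ∈ Finset.univ.filter fun i : Fin p => ((i : ℕ) : ℝ) + 1 ≤ b * p,
          pinskerFilter a γ i := by
          refine Finset.sum_le_sum fun i hi => ?_
          have h1 := ha.1 i (Finset.mem_filter.1 hi).2
          rw [pinskerFilter, pinskerUnit_of_one h1, max_eq_left (by linarith)]
          simpa using hf
      _ ≤ _ := Finset.sum_le_sum_of_subset_of_nonneg (Finset.filter_subset _ _)
          fun i _ _ => pinskerFilter_nonneg a γ i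
  have h2 : b * p / 2 * (t / 2) ≤ ∑ i, pinskerFilter a γ i :=
    (mul_le_mul_of_nonneg_right (card_unit_weights hb1 h) (by positivity)).trans h1
  have h3 : b * t / 4 ≤ (∑ i, pinskerFilter a γ i) / p := by
    rw [le_div_iff₀ hp]; linarith
  calc v * b * t / 4 = v * (b * t / 4) := by ring
    _ ≤ _ := mul_le_mul_of_nonneg_left h3 hv.le

/-! ### Deterministic maximal inequalities and Abel summation. -/

/-- The running maximum of the absolute values of a sequence. -/
def runMax (S : ℕ → ℝ) : ℕ → ℝ
  | 0 => |S 0|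
  | n + 1 => max (runMax S n) |S (n + 1)|

lemma abs_le_runMax (S : ℕ → ℝ) (n : ℕ) : |S n| ≤ runMax S n := by
  cases n with
  | zero => exact le_rfl
  | succ n => exact le_max_right _ _

lemma runMax_le_succ (S : ℕ → ℝ) (n : ℕ) : runMax S n ≤ runMax S (n + 1) := le_max_left _ _

lemma runMax_nonneg (S : ℕ → ℝ) (n : ℕ) : 0 ≤ runMax S n :=
  (abs_nonneg _).trans (abs_le_runMax S n)

/-- A sign that never vanishes. -/
def unitSign (x : ℝ) : ℝ := if 0 ≤ x then 1 else -1

lemma unitSign_mul_self (x : ℝ) : unitSign x * x = |x| := by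
  unfold unitSign
  split_ifs with h
  · rw [one_mul, abs_of_nonneg h]
  · rw [abs_of_neg (not_le.1 h)]; ring

lemma abs_unitSign (x : ℝ) : |unitSign x| = 1 := by
  unfold unitSign
  split_ifs <;> simp

lemma measurable_unitSign : Measurable unitSign :=
  Measurable.ite measurableSet_Ici measurable_const measurable_const

/-- A pathwise form of Doob's `L²` maximal inequality. -/
lemma runMax_sq_le (S : ℕ → ℝ) (h0 : S 0 = 0) (n : ℕ) :
    runMax S n ^ 2 ≤ 4 * S n ^ 2 -
      4 * ∑ k ∈ Finset.range n, runMax S k * unitSign (S k) * (S (k + 1) - S k) := by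
  -- With `M` the running maximum, the sum is at most `∑ M_k (|S_{k+1}| - |S_k|)`. Summation by
  -- parts works because `M` grows only when it equals `|S|`; the jump costs `(M - |S|)² / 2`. The
  -- claim then follows from `4 S² - 4 M |S| + 2 M² = M² + (M - 2 |S|)²`.
  have key : ∀ n, ∑ k ∈ Finset.range n,
      runMax S k * unitSign (S k) * (S (k + 1) - S k) ≤
        runMax S n * |S n| - runMax S n ^ 2 / 2 := by
    intro n
    induction n with
    | zero => simp [runMax, h0]
    | succ n ih =>
      rw [Finset.sum_range_succ]
      have h1 : unitSign (S n) * (S (n + 1) - S n) ≤ |S (n + 1)| - |S n| := by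
        rw [mul_sub, unitSign_mul_self]
        refine sub_le_sub_right ?_ _
        refine (le_abs_self _).trans ?_
        rw [abs_mul, abs_unitSign, one_mul]
      have h2 := mul_le_mul_of_nonneg_left h1 (runMax_nonneg S n)
      have h3 : runMax S (n + 1) = max (runMax S n) |S (n + 1)| := rfl
      rcases max_cases (runMax S n) |S (n + 1)| with h | h
      · rw [h3, h.1]; linarith
      · rw [h3, h.1]
        nlinarith [sq_nonneg (runMax S n - |S (n + 1)|)]
  have := key n
  nlinarith [sq_abs (S n), sq_nonneg (runMax S n - 2 * |S n|)]

/-- Abel summation writes the sum as a combination of partial sums with nonnegative coefficients `f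
k - f (k + 1)` and `f n`, of total mass `f 0 ≤ 1`. A supremum over the whole monotone class thereby
becomes a maximum over partial sums. -/
lemma abs_sum_mul_le_runMax {f : ℕ → ℝ} (hf : Antitone f) (hf0 : ∀ i, 0 ≤ f i)
    (hf1 : ∀ i, f i ≤ 1) (w : ℕ → ℝ) (n : ℕ) :
    |∑ i ∈ Finset.range n, f i * w i| ≤ runMax (fun k => ∑ i ∈ Finset.range k, w i) n := by
  set S : ℕ → ℝ := fun k => ∑ i ∈ Finset.range k, w i with hS
  have key : ∀ n, |∑ i ∈ Finset.range n, f i * w i - f n * S n| ≤ (f 0 - f n) * runMax S n := by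
    intro n
    induction n with
    | zero => simp [hS]
    | succ n ih =>
      have h1 : ∑ i ∈ Finset.range (n + 1), f i * w i - f (n + 1) * S (n + 1) =
          (∑ i ∈ Finset.range n, f i * w i - f n * S n) + (f n - f (n + 1)) * S (n + 1) := by
        simp only [hS, Finset.sum_range_succ]
        ring
      rw [h1]
      refine (abs_add_le _ _).trans ?_
      have h2 : |(f n - f (n + 1)) * S (n + 1)| ≤ (f n - f (n + 1)) * runMax S (n + 1) := by
        rw [abs_mul, abs_of_nonneg (sub_nonneg.2 (hf n.le_succ))]
        exact mul_le_mul_of_nonneg_left (abs_le_runMax S _) (sub_nonneg.2 (hf n.le_succ))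
      have h3 : (f 0 - f n) * runMax S n ≤ (f 0 - f n) * runMax S (n + 1) :=
        mul_le_mul_of_nonneg_left (runMax_le_succ S n) (sub_nonneg.2 (hf n.zero_le))
      linarith
  have h1 := key n
  have h2 : |f n * S n| ≤ f n * runMax S n := by
    rw [abs_mul, abs_of_nonneg (hf0 n)]
    exact mul_le_mul_of_nonneg_left (abs_le_runMax S n) (hf0 n)
  have h3 : ∑ i ∈ Finset.range n, f i * w i =
      (∑ i ∈ Finset.range n, f i * w i - f n * S n) + f n * S n := by ring
  rw [h3]
  refine (abs_add_le _ _).trans ?_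
  nlinarith [runMax_nonneg S n, hf1 0]

/-- Extension of a finite vector by zero. -/
def extendZero {p : ℕ} (x : Fin p → ℝ) (i : ℕ) : ℝ := if h : i < p then x ⟨i, h⟩ else 0

/-- The partial sums of a finite vector. -/
def partialSum {p : ℕ} (w : Fin p → ℝ) (k : ℕ) : ℝ := ∑ i ∈ Finset.range k, extendZero w i

lemma partialSum_self {p : ℕ} (w : Fin p → ℝ) : partialSum w p = ∑ i, w i := by
  rw [partialSum, Finset.sum_range]
  exact Finset.sum_congr rfl fun i _ => by simp [extendZero]

lemma abs_sum_mul_le {p : ℕ} {f : Fin p → ℝ} (hf : f ∈ monotoneClass p) (w : Fin p → ℝ) :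
    |∑ i, f i * w i| ≤ runMax (partialSum w) p := by
  have h := abs_sum_mul_le_runMax (f := extendZero f) ?_ ?_ ?_ (extendZero w) p
  · rw [Finset.sum_range] at h
    refine le_trans (le_of_eq ?_) h
    simp [extendZero]
  · intro i j hij
    unfold extendZero
    split_ifs with h1 h2 h2
    · exact hf.2 hij
    · exact absurd (hij.trans_lt h1) h2
    · exact (hf.1 _).1
    · exact le_rfl
  · intro i
    unfold extendZero
    split_ifs
    · exact (hf.1 _).1
    · exact le_rfl
  · intro i
    unfold extendZero
    split_ifs
    · exact (hf.1 _).2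
    · exact zero_le_one

/-! ### Minimizers of the estimated risk: oracle inequality, stability, measurability. -/

/-- The estimated risk without normalization. -/
def estimatedSum {p : ℕ} (z : Fin p → ℝ) (s : ℝ) (f : Fin p → ℝ) : ℝ :=
  ∑ i, (f i ^ 2 * s + (1 - f i) ^ 2 * (z i ^ 2 - s))

/-- `f` minimizes the estimated risk over the monotone class. -/
def IsRiskMinimizer {p : ℕ} (z : Fin p → ℝ) (s : ℝ) (f : Fin p → ℝ) : Prop :=
  f ∈ monotoneClass p ∧ ∀ g ∈ monotoneClass p, estimatedSum z s f ≤ estimatedSum z s g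

lemma IsAdaptiveShrinkage.isRiskMinimizer {n p : ℕ} (hp : 0 < p) {U : Matrix (Fin n) (Fin p) ℝ}
    {s : EuclideanSpace ℝ (Fin n) → ℝ} {fhat : EuclideanSpace ℝ (Fin n) → Fin p → ℝ}
    (h : IsAdaptiveShrinkage U s fhat) (y : EuclideanSpace ℝ (Fin n)) :
    IsRiskMinimizer (canonicalObs U y) (s y) (fhat y) := by
  refine ⟨(h y).1, fun g hg => ?_⟩
  have hp' : (0 : ℝ) < p := by exact_mod_cast hp
  exact (div_le_div_iff_of_pos_right hp').1 ((h y).2 g hg)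

/-- The oracle inequality for the shrinkage vector that minimizes the estimated risk. -/
lemma IsRiskMinimizer.loss_le {p : ℕ} {z : Fin p → ℝ} {s : ℝ} {fh : Fin p → ℝ}
    (h : IsRiskMinimizer z s fh) {f : Fin p → ℝ} (hf : f ∈ monotoneClass p) (ξ : Fin p → ℝ)
    (v : ℝ) :
    ∑ i, (fh i * z i - ξ i) ^ 2 ≤ ∑ i, (f i * z i - ξ i) ^ 2 +
      4 * runMax (partialSum fun i => z i * (z i - ξ i) - v) p + 2 * (p * |s - v|) := by
  -- Loss minus estimated risk is affine in `g`. Comparing `fh` with `f` removes the constant and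
  -- uses the Abel bound twice, whence the factor `4`.
  have key : ∀ g : Fin p → ℝ, ∑ i, (g i * z i - ξ i) ^ 2 = estimatedSum z s g +
      ∑ i, (ξ i ^ 2 - z i ^ 2 + s) + 2 * ∑ i, g i * (z i * (z i - ξ i) - v) +
      2 * ((v - s) * ∑ i, g i) := by
    intro g
    rw [estimatedSum, Finset.mul_sum, Finset.mul_sum, Finset.mul_sum, ← Finset.sum_add_distrib,
      ← Finset.sum_add_distrib, ← Finset.sum_add_distrib]
    exact Finset.sum_congr rfl fun i _ => by ring
  rw [key fh, key f]
  have h1 := h.2 f hf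
  have h2 := abs_le.1 (abs_sum_mul_le h.1 fun i => z i * (z i - ξ i) - v)
  have h3 := abs_le.1 (abs_sum_mul_le hf fun i => z i * (z i - ξ i) - v)
  have h4 : (v - s) * ∑ i, fh i - (v - s) * ∑ i, f i ≤ p * |s - v| := by
    rw [← mul_sub, ← Finset.sum_sub_distrib]
    refine (le_abs_self _).trans ?_
    rw [abs_mul, abs_sub_comm, mul_comm]
    refine mul_le_mul_of_nonneg_right ?_ (abs_nonneg _)
    refine (Finset.abs_sum_le_sum_abs _ _).trans ?_
    have : ∑ i : Fin p, |fh i - f i| ≤ ∑ _i : Fin p, (1 : ℝ) := Finset.sum_le_sum fun i _ => by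
      have a1 := h.1.1 i
      have a2 := hf.1 i
      rw [abs_le]
      constructor <;> linarith [a1.1, a1.2, a2.1, a2.2]
    simpa using this
  linarith [h2.2, h3.1]

lemma monotoneClass_midpoint {p : ℕ} {f g : Fin p → ℝ} (hf : f ∈ monotoneClass p)
    (hg : g ∈ monotoneClass p) : (fun i => (f i + g i) / 2) ∈ monotoneClass p := by
  refine ⟨fun i => ?_, fun i j hij => ?_⟩
  · have h1 := hf.1 i
    have h2 := hg.1 i
    constructor <;> linarith [h1.1, h1.2, h2.1, h2.2]
  · have h1 := hf.2 hij
    have h2 := hg.2 hij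
    simp only
    linarith

lemma isCompact_monotoneClass (p : ℕ) : IsCompact (monotoneClass p) := by
  refine (isCompact_univ_pi fun _ : Fin p => isCompact_Icc (a := (0 : ℝ)) (b := 1)).of_isClosed_subset
    ?_ fun f hf i _ => hf.1 i
  have : monotoneClass p = (⋂ i, {f : Fin p → ℝ | f i ∈ Set.Icc (0 : ℝ) 1}) ∩
      ⋂ i, ⋂ j, ⋂ (_ : i ≤ j), {f : Fin p → ℝ | f j ≤ f i} := by
    ext f
    simp only [monotoneClass, Set.mem_ofPred_eq, Set.mem_inter_iff, Set.mem_iInter]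
    exact Iff.rfl
  rw [this]
  refine (isClosed_iInter fun i => isClosed_Icc.preimage (continuous_apply i)).inter
    (isClosed_iInter fun i => isClosed_iInter fun j => isClosed_iInter fun _ =>
      isClosed_le (continuous_apply j) (continuous_apply i))

lemma exists_isRiskMinimizer {p : ℕ} (z : Fin p → ℝ) (s : ℝ) : ∃ f, IsRiskMinimizer z s f := by
  have hc : Continuous (estimatedSum z s) := by
    unfold estimatedSum
    fun_prop
  obtain ⟨f, hf, hmin⟩ := (isCompact_monotoneClass p).exists_isMinOn
    ⟨0, ⟨fun i => by simp, antitone_const⟩⟩ hc.continuousOn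
  exact ⟨f, hf, fun g hg => hmin hg⟩

/-- Strong convexity of the estimated risk. -/
lemma IsRiskMinimizer.sum_sq_le {p : ℕ} {z : Fin p → ℝ} {s : ℝ} {f : Fin p → ℝ}
    (h : IsRiskMinimizer z s f) {g : Fin p → ℝ} (hg : g ∈ monotoneClass p) :
    ∑ i, z i ^ 2 * (g i - f i) ^ 2 ≤ 2 * (estimatedSum z s g - estimatedSum z s f) := by
  have h1 := h.2 _ (monotoneClass_midpoint h.1 hg)
  -- The coefficient of `f i ^ 2` is `s + (z i ^ 2 - s) = z i ^ 2`, so convexity holds whatever the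
  -- sign of `s`.
  have h2 : ∑ i, z i ^ 2 * (g i - f i) ^ 2 = 2 * estimatedSum z s f + 2 * estimatedSum z s g -
      4 * estimatedSum z s fun i => (f i + g i) / 2 := by
    simp only [estimatedSum, Finset.mul_sum]
    rw [← Finset.sum_add_distrib, ← Finset.sum_sub_distrib]
    exact Finset.sum_congr rfl fun i _ => by ring
  linarith

/-- A bound on the change of the estimated risk when the data change. -/
def dataGap {p : ℕ} (z z' : Fin p → ℝ) (s s' : ℝ) : ℝ :=
  ∑ i, (|s - s'| + |(z i ^ 2 - s) - (z' i ^ 2 - s')|)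

lemma estimatedSum_sub_le {p : ℕ} (z z' : Fin p → ℝ) (s s' : ℝ) {f : Fin p → ℝ}
    (hf : f ∈ monotoneClass p) :
    |estimatedSum z s f - estimatedSum z' s' f| ≤ dataGap z z' s s' := by
  rw [estimatedSum, estimatedSum, ← Finset.sum_sub_distrib]
  refine (Finset.abs_sum_le_sum_abs _ _).trans (Finset.sum_le_sum fun i _ => ?_)
  have h1 := hf.1 i
  have h2 : f i ^ 2 * s + (1 - f i) ^ 2 * (z i ^ 2 - s) -
      (f i ^ 2 * s' + (1 - f i) ^ 2 * (z' i ^ 2 - s')) =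
      f i ^ 2 * (s - s') + (1 - f i) ^ 2 * ((z i ^ 2 - s) - (z' i ^ 2 - s')) := by ring
  rw [h2]
  refine (abs_add_le _ _).trans (add_le_add ?_ ?_)
  · rw [abs_mul, abs_of_nonneg (sq_nonneg _)]
    exact mul_le_of_le_one_left (abs_nonneg _) (by nlinarith [h1.1, h1.2])
  · rw [abs_mul, abs_of_nonneg (sq_nonneg _)]
    exact mul_le_of_le_one_left (abs_nonneg _) (by nlinarith [h1.1, h1.2])

/-- Changing the data moves each of the two risks by at most the gap, so `f'` is within twice the
gap of optimal for `(z, s)`; strong convexity doubles this. -/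
lemma IsRiskMinimizer.sum_sq_sub_le {p : ℕ} {z z' : Fin p → ℝ} {s s' : ℝ} {f f' : Fin p → ℝ}
    (h : IsRiskMinimizer z s f) (h' : IsRiskMinimizer z' s' f') :
    ∑ i, z i ^ 2 * (f' i - f i) ^ 2 ≤ 4 * dataGap z z' s s' := by
  have h1 := h.sum_sq_le h'.1
  have h2 := h'.2 f h.1
  have h3 := abs_le.1 (estimatedSum_sub_le z z' s s' h'.1)
  have h4 := abs_le.1 (estimatedSum_sub_le z z' s s' h.1)
  linarith [h3.2, h4.1]

/-- The stability bound carries the weights `z i ^ 2`, so it controls every coordinate exactly where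
no `z i` vanishes. The selection `G` may be arbitrary. -/
lemma continuousOn_riskMinimizer {p : ℕ} {G : (Fin p → ℝ) × ℝ → Fin p → ℝ}
    (hG : ∀ x, IsRiskMinimizer x.1 x.2 (G x)) :
    ContinuousOn G {x | ∀ i, x.1 i ≠ 0} := by
  intro x hx
  refine ContinuousAt.continuousWithinAt ?_
  refine tendsto_pi_nhds.2 fun i => ?_
  have hgap : Tendsto (fun y : (Fin p → ℝ) × ℝ => 4 * dataGap x.1 y.1 x.2 y.2 / x.1 i ^ 2)
      (𝓝 x) (𝓝 0) := by
    have hc : Continuous fun y : (Fin p → ℝ) × ℝ =>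
        4 * dataGap x.1 y.1 x.2 y.2 / x.1 i ^ 2 := by
      unfold dataGap
      fun_prop
    have := hc.tendsto x
    simpa [dataGap] using this
  have hsq : Tendsto (fun y => (G y i - G x i) ^ 2) (𝓝 x) (𝓝 0) := by
    refine squeeze_zero (fun _ => sq_nonneg _) (fun y => ?_) hgap
    have hxi : 0 < x.1 i ^ 2 := by have := hx i; positivity
    rw [le_div_iff₀ hxi, mul_comm]
    refine le_trans ?_ ((hG x).sum_sq_sub_le (hG y))
    exact Finset.single_le_sum (f := fun i => x.1 i ^ 2 * (G y i - G x i) ^ 2)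
      (fun j _ => by positivity) (Finset.mem_univ i)
  have habs := hsq.sqrt
  simp only [Real.sqrt_sq_eq_abs, Real.sqrt_zero] at habs
  exact tendsto_iff_norm_sub_tendsto_zero.2 habs

/-- Where no coordinate vanishes, the minimizer is unique and depends measurably on the data. -/
lemma exists_measurable_riskMinimizer (p : ℕ) :
    ∃ G : (Fin p → ℝ) × ℝ → Fin p → ℝ, Measurable G ∧
      ∀ z s f, (∀ i, z i ≠ 0) → IsRiskMinimizer z s f → G (z, s) = f := by
  classical
  choose G₀ hG₀ using fun x : (Fin p → ℝ) × ℝ => exists_isRiskMinimizer x.1 x.2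
  have hW : MeasurableSet {x : (Fin p → ℝ) × ℝ | ∀ i, x.1 i ≠ 0} := by
    simp only [Set.ofPred_forall]
    refine MeasurableSet.iInter fun i => ?_
    have : Measurable fun x : (Fin p → ℝ) × ℝ => x.1 i := by fun_prop
    exact (this (measurableSet_singleton 0)).compl
  -- Any selection is continuous off the coordinate hyperplanes; resetting it to `0` on them makes
  -- it measurable.
  refine ⟨Set.piecewise {x | ∀ i, x.1 i ≠ 0} G₀ 0,
    (continuousOn_riskMinimizer hG₀).measurable_piecewise continuousOn_const hW, ?_⟩
  intro z s f hz hf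
  rw [Set.piecewise_eq_of_mem _ _ _ (show (z, s) ∈ {x : (Fin p → ℝ) × ℝ | ∀ i, x.1 i ≠ 0} from hz)]
  have h1 : ∑ i, z i ^ 2 * (G₀ (z, s) i - f i) ^ 2 ≤ 0 := by
    have := hf.sum_sq_sub_le (hG₀ (z, s))
    simpa [dataGap] using this
  funext i
  have h2 := (Finset.single_le_sum (f := fun i => z i ^ 2 * (G₀ (z, s) i - f i) ^ 2)
      (fun j _ => by positivity) (Finset.mem_univ i)).trans h1
  have h3 : 0 < z i ^ 2 := by have := hz i; positivity
  have h4 : (G₀ (z, s) i - f i) ^ 2 = 0 :=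
    le_antisymm (nonpos_of_mul_nonpos_right h2 h3) (sq_nonneg _)
  exact sub_eq_zero.1 (pow_eq_zero_iff two_ne_zero |>.1 h4)

/-! ### The maximal inequality for independent centred variables. -/

lemma partialSum_congr {p : ℕ} {x x' : Fin p → ℝ} {k : ℕ} (h : ∀ i : Fin p, (i : ℕ) < k → x i = x' i)
    {j : ℕ} (hj : j ≤ k) : partialSum x j = partialSum x' j := by
  refine Finset.sum_congr rfl fun i hi => ?_
  unfold extendZero
  split_ifs with hip
  · exact h _ ((Finset.mem_range.1 hi).trans_le hj)
  · rfl

lemma runMax_congr {S S' : ℕ → ℝ} {k : ℕ} (h : ∀ j ≤ k, S j = S' j) : runMax S k = runMax S' k := by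
  induction k with
  | zero => simp [runMax, h 0 le_rfl]
  | succ k ih =>
    simp only [runMax]
    rw [ih fun j hj => h j (hj.trans k.le_succ), h (k + 1) le_rfl]

lemma continuous_partialSum {p : ℕ} (k : ℕ) : Continuous fun x : Fin p → ℝ => partialSum x k := by
  unfold partialSum
  refine continuous_finsetSum _ fun i _ => ?_
  unfold extendZero
  split_ifs <;> fun_prop

lemma continuous_runMax_partialSum {p : ℕ} (k : ℕ) :
    Continuous fun x : Fin p → ℝ => runMax (partialSum x) k := by
  induction k with
  | zero => exact (continuous_partialSum 0).abs
  | succ k ih => exact ih.max (continuous_partialSum (k + 1)).abs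

section MaximalInequality

variable {Ω : Type*} [MeasurableSpace Ω] {P : Measure Ω}

lemma memLp_partialSum {p : ℕ} {X : Fin p → Ω → ℝ} (h2 : ∀ i, MemLp (X i) 2 P) (k : ℕ) :
    MemLp (fun ω => partialSum (fun i => X i ω) k) 2 P := by
  unfold partialSum
  refine memLp_finsetSum _ fun i _ => ?_
  unfold extendZero
  split_ifs with h
  · exact h2 _
  · exact MemLp.zero

lemma memLp_runMax {p : ℕ} {X : Fin p → Ω → ℝ} (h2 : ∀ i, MemLp (X i) 2 P) (k : ℕ) :
    MemLp (fun ω => runMax (partialSum fun i => X i ω) k) 2 P := by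
  induction k with
  | zero => exact (memLp_partialSum h2 0).abs
  | succ k ih => exact ih.sup (memLp_partialSum h2 (k + 1)).abs

/-- Padding the coordinates below `k` with zeros lets the running maximum at time `k` be written as
a function of these coordinates alone. -/
lemma measurable_extend_subtype {p : ℕ} (k : ℕ) :
    Measurable fun (u : (Finset.univ.filter fun j : Fin p => (j : ℕ) < k) → ℝ) (i : Fin p) =>
      if h : (i : ℕ) < k then u ⟨i, by simpa using h⟩ else 0 := by
  refine measurable_pi_lambda _ fun i => ?_
  split_ifs
  · exact measurable_pi_apply _
  · exact measurable_const

lemma integral_sum_sq [IsProbabilityMeasure P] {p : ℕ} {X : Fin p → Ω → ℝ}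
    (hm : ∀ i, Measurable (X i)) (hind : iIndepFun X P) (h2 : ∀ i, MemLp (X i) 2 P)
    (h0 : ∀ i, ∫ ω, X i ω ∂P = 0) :
    ∫ ω, (∑ i, X i ω) ^ 2 ∂P = ∑ i, ∫ ω, X i ω ^ 2 ∂P := by
  have h3 := IndepFun.variance_sum (s := Finset.univ) (fun i _ => h2 i)
    (fun i _ j _ hij => hind.indepFun hij)
  rw [variance_of_integral_eq_zero] at h3
  · simp only [Finset.sum_apply] at h3
    rw [h3]
    exact Finset.sum_congr rfl fun i _ =>
      variance_of_integral_eq_zero (hm i).aemeasurable (h0 i)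
  · exact (Finset.aemeasurable_sum _ fun i _ => (hm i).aemeasurable)
  · simp only [Finset.sum_apply]
    rw [integral_finsetSum _ fun i _ => (h2 i).integrable (by norm_num)]
    simp [h0]

/-- A Doob-Kolmogorov maximal inequality for independent centred random variables. -/
theorem integral_runMax_sq_le [IsProbabilityMeasure P] {p : ℕ} {X : Fin p → Ω → ℝ}
    (hm : ∀ i, Measurable (X i)) (hind : iIndepFun X P) (h2 : ∀ i, MemLp (X i) 2 P)
    (h0 : ∀ i, ∫ ω, X i ω ∂P = 0) :
    ∫ ω, runMax (partialSum fun i => X i ω) p ^ 2 ∂P ≤ 4 * ∑ i, ∫ ω, X i ω ^ 2 ∂P := by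
  set S : Ω → ℕ → ℝ := fun ω => partialSum fun i => X i ω with hS
  set V : ℕ → Ω → ℝ := fun k ω => runMax (S ω) k * unitSign (S ω k) with hV
  have hVm : ∀ k, MemLp (V k) 2 P := fun k => by
    have hmeas : Measurable (V k) := by
      have h1 : Measurable fun ω => fun i => X i ω := measurable_pi_lambda _ hm
      exact ((continuous_runMax_partialSum k).measurable.comp h1).mul
        (measurable_unitSign.comp ((continuous_partialSum k).measurable.comp h1))
    refine (memLp_runMax h2 k).of_le hmeas.aestronglyMeasurable (ae_of_all _ fun ω => ?_)
    simp only [hV, norm_mul, Real.norm_eq_abs, abs_unitSign, mul_one]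
    exact le_rfl
  have hD : ∀ k, MemLp (fun ω => S ω (k + 1) - S ω k) 2 P := fun k =>
    (memLp_partialSum h2 (k + 1)).sub (memLp_partialSum h2 k)
  have hint : ∀ k, Integrable (fun ω => V k ω * (S ω (k + 1) - S ω k)) P := fun k =>
    (hVm k).integrable_mul (hD k)
  -- `V k` depends only on the variables with index below `k`, hence is independent of the centred
  -- increment: the correction in the pathwise inequality has mean zero.
  have hzero : ∀ k ∈ Finset.range p, ∫ ω, V k ω * (S ω (k + 1) - S ω k) ∂P = 0 := by
    intro k hk
    have hk' := Finset.mem_range.1 hk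
    have hinc : ∀ ω, S ω (k + 1) - S ω k = X ⟨k, hk'⟩ ω := fun ω => by
      simp [hS, partialSum, Finset.sum_range_succ, extendZero, hk']
    simp_rw [hinc]
    have hdisj : Disjoint (Finset.univ.filter fun j : Fin p => (j : ℕ) < k) {⟨k, hk'⟩} := by
      simp
    have hI := hind.indepFun_finset _ _ hdisj hm
    have hφ : Measurable fun (u : (Finset.univ.filter fun j : Fin p => (j : ℕ) < k) → ℝ) =>
        runMax (partialSum fun i : Fin p => if h : (i : ℕ) < k then u ⟨i, by simpa using h⟩ else 0) k
          * unitSign (partialSum (fun i : Fin p =>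
            if h : (i : ℕ) < k then u ⟨i, by simpa using h⟩ else 0) k) :=
      ((continuous_runMax_partialSum k).measurable.comp (measurable_extend_subtype k)).mul
        (measurable_unitSign.comp
          ((continuous_partialSum k).measurable.comp (measurable_extend_subtype k)))
    have hI2 := hI.comp hφ (measurable_pi_apply (⟨⟨k, hk'⟩, Finset.mem_singleton_self _⟩ :
      ({⟨k, hk'⟩} : Finset (Fin p))))
    have hI3 : IndepFun (V k) (X ⟨k, hk'⟩) P := by
      refine hI2.congr (ae_of_all _ fun ω => ?_) (ae_of_all _ fun ω => rfl)
      have hc : ∀ j ≤ k, partialSum (fun i : Fin p => if (i : ℕ) < k then X i ω else 0) j =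
          partialSum (fun i => X i ω) j := fun j hj =>
        partialSum_congr (fun i hi => by simp [hi]) hj
      simp only [Function.comp_apply, hV, hS, dite_eq_ite]
      rw [runMax_congr hc, hc k le_rfl]
    rw [hI3.integral_fun_mul_eq_mul_integral (hVm k).aestronglyMeasurable
      (h2 _).aestronglyMeasurable, h0, mul_zero]
  have hSp : ∫ ω, S ω p ^ 2 ∂P = ∑ i, ∫ ω, X i ω ^ 2 ∂P := by
    rw [← integral_sum_sq hm hind h2 h0]
    simp only [hS, partialSum_self]
  calc ∫ ω, runMax (S ω) p ^ 2 ∂P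
      ≤ ∫ ω, (4 * S ω p ^ 2 - 4 * ∑ k ∈ Finset.range p, V k ω * (S ω (k + 1) - S ω k)) ∂P := by
        refine integral_mono (memLp_runMax h2 p).integrable_sq ?_ fun ω => ?_
        · exact ((memLp_partialSum h2 p).integrable_sq.const_mul 4).sub
            ((integrable_finsetSum _ fun k _ => hint k).const_mul 4)
        · exact runMax_sq_le _ (by simp [hS, partialSum]) p
    _ = 4 * ∑ i, ∫ ω, X i ω ^ 2 ∂P := by
        rw [integral_sub ((memLp_partialSum h2 p).integrable_sq.const_mul 4)
          ((integrable_finsetSum _ fun k _ => hint k).const_mul 4), integral_const_mul,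
          integral_const_mul, integral_finsetSum _ fun k _ => hint k, Finset.sum_eq_zero hzero,
          hSp]
        ring

end MaximalInequality

/-! ### The observation law -/

instance {n : ℕ} (η : EuclideanSpace ℝ (Fin n)) (v : ℝ) : IsGaussian (obsLaw η v) := by
  unfold obsLaw; infer_instance

/-- By translation, all risks become integrals against one centred noise law. -/
lemma obsLaw_eq_map {n : ℕ} (η : EuclideanSpace ℝ (Fin n)) (v : ℝ) :
    obsLaw η v = (obsLaw 0 v).map (fun x => η + x) := by
  unfold obsLaw multivariateGaussian
  rw [Measure.map_map (by fun_prop) (by fun_prop)]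
  congr 1
  funext x
  simp

lemma posSemidef_smul_one {n : ℕ} {v : ℝ} (hv : 0 ≤ v) :
    (v • (1 : Matrix (Fin n) (Fin n) ℝ)).PosSemidef :=
  Matrix.PosSemidef.one.smul hv

lemma cov_inner_obsLaw {n : ℕ} {v : ℝ} (hv : 0 ≤ v) (x y : EuclideanSpace ℝ (Fin n)) :
    cov[fun u => inner ℝ x u, fun u => inner ℝ y u; obsLaw 0 v] = v * inner ℝ x y := by
  rw [← covarianceBilin_apply_eq_cov IsGaussian.memLp_two_id, obsLaw,
    covarianceBilin_multivariateGaussian (posSemidef_smul_one hv)]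
  rw [Matrix.smul_mulVec, Matrix.one_mulVec, dotProduct_smul, smul_eq_mul, PiLp.inner_apply]
  simp [dotProduct, mul_comm]

/-- The columns of the design matrix as vectors. -/
def column {n p : ℕ} (U : Matrix (Fin n) (Fin p) ℝ) (i : Fin p) : EuclideanSpace ℝ (Fin n) :=
  WithLp.toLp 2 fun j => U j i

lemma canonicalObs_apply {n p : ℕ} (U : Matrix (Fin n) (Fin p) ℝ) (y : EuclideanSpace ℝ (Fin n))
    (i : Fin p) : canonicalObs U y i = inner ℝ (column U i) y := by
  simp [canonicalObs, Matrix.mulVec, dotProduct, column, PiLp.inner_apply, mul_comm]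

lemma inner_column {n p : ℕ} {U : Matrix (Fin n) (Fin p) ℝ} (hU : Uᵀ * U = 1) (i j : Fin p) :
    inner ℝ (column U i) (column U j) = if i = j then 1 else 0 := by
  have h := congrFun (congrFun hU i) j
  rw [Matrix.mul_apply, Matrix.one_apply] at h
  rw [← h]
  simp [column, PiLp.inner_apply, mul_comm]

lemma canonicalObs_add {n p : ℕ} (U : Matrix (Fin n) (Fin p) ℝ) (y y' : EuclideanSpace ℝ (Fin n))
    (i : Fin p) : canonicalObs U (y + y') i = canonicalObs U y i + canonicalObs U y' i := by
  simp [canonicalObs_apply, inner_add_right]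

lemma canonicalObs_meanOf {n p : ℕ} {U : Matrix (Fin n) (Fin p) ℝ} (hU : Uᵀ * U = 1)
    (ξ : Fin p → ℝ) : canonicalObs U (meanOf U ξ) = ξ := by
  simp [canonicalObs, meanOf, hU]

lemma meanOf_eq_sum {n p : ℕ} (U : Matrix (Fin n) (Fin p) ℝ) (ξ : Fin p → ℝ) :
    meanOf U ξ = ∑ i, ξ i • column U i := by
  ext j
  simp [meanOf, Matrix.mulVec, dotProduct, column, mul_comm]

lemma norm_meanOf_sq {n p : ℕ} {U : Matrix (Fin n) (Fin p) ℝ} (hU : Uᵀ * U = 1) (ξ : Fin p → ℝ) :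
    ‖meanOf U ξ‖ ^ 2 = ∑ i, ξ i ^ 2 := by
  rw [← real_inner_self_eq_norm_sq]
  nth_rewrite 1 [meanOf_eq_sum]
  rw [sum_inner]
  refine Finset.sum_congr rfl fun i _ => ?_
  rw [real_inner_smul_left, ← canonicalObs_apply, canonicalObs_meanOf hU, sq]

lemma norm_meanOf_sub_sq {n p : ℕ} {U : Matrix (Fin n) (Fin p) ℝ} (hU : Uᵀ * U = 1)
    (x ξ : Fin p → ℝ) : ‖meanOf U x - meanOf U ξ‖ ^ 2 = ∑ i, (x i - ξ i) ^ 2 := by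
  have : meanOf U x - meanOf U ξ = meanOf U (x - ξ) := by
    ext j
    simp [meanOf, Matrix.mulVec_sub]
  rw [this, norm_meanOf_sq hU]
  rfl

/-- The canonical coordinates contract distances. -/
lemma sum_sq_canonicalObs_sub_le {n p : ℕ} {U : Matrix (Fin n) (Fin p) ℝ} (hU : Uᵀ * U = 1)
    (x : EuclideanSpace ℝ (Fin n)) (ξ : Fin p → ℝ) :
    ∑ i, (canonicalObs U x i - ξ i) ^ 2 ≤ ‖x - meanOf U ξ‖ ^ 2 := by
  have h : Orthonormal ℝ (column U) := by
    rw [orthonormal_iff_ite]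
    exact inner_column hU
  refine le_trans (le_of_eq ?_) (h.sum_inner_products_le (s := Finset.univ) (x - meanOf U ξ))
  refine Finset.sum_congr rfl fun i _ => ?_
  rw [Real.norm_eq_abs, sq_abs, inner_sub_right, ← canonicalObs_apply, ← canonicalObs_apply,
    canonicalObs_meanOf hU]

lemma continuous_canonicalObs {n p : ℕ} (U : Matrix (Fin n) (Fin p) ℝ) :
    Continuous (canonicalObs U) := by
  refine continuous_pi fun i => ?_
  simp_rw [canonicalObs_apply]
  fun_prop

lemma continuous_meanOf {n p : ℕ} (U : Matrix (Fin n) (Fin p) ℝ) : Continuous (meanOf U) := by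
  simp_rw [funext (meanOf_eq_sum U)]
  fun_prop

lemma measurable_canonicalObs_apply {n p : ℕ} (U : Matrix (Fin n) (Fin p) ℝ) (i : Fin p) :
    Measurable fun y => canonicalObs U y i :=
  ((continuous_apply i).comp (continuous_canonicalObs U)).measurable

lemma hasGaussianLaw_canonicalObs {n p : ℕ} (U : Matrix (Fin n) (Fin p) ℝ) (v : ℝ) :
    HasGaussianLaw (fun y i => canonicalObs U y i) (obsLaw 0 v) := by
  have h := (IsGaussian.hasGaussianLaw_id (μ := obsLaw (0 : EuclideanSpace ℝ (Fin n)) v)).map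
    (ContinuousLinearMap.pi fun i => innerSL ℝ (column U i))
  convert! h using 1
  funext y i
  simp [canonicalObs_apply]

lemma cov_canonicalObs {n p : ℕ} {U : Matrix (Fin n) (Fin p) ℝ} (hU : Uᵀ * U = 1) {v : ℝ}
    (hv : 0 ≤ v) (i j : Fin p) :
    cov[fun y => canonicalObs U y i, fun y => canonicalObs U y j; obsLaw 0 v] =
      if i = j then v else 0 := by
  simp_rw [canonicalObs_apply]
  rw [cov_inner_obsLaw hv, inner_column hU]
  split_ifs <;> simp

lemma iIndepFun_canonicalObs {n p : ℕ} {U : Matrix (Fin n) (Fin p) ℝ} (hU : Uᵀ * U = 1) {v : ℝ}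
    (hv : 0 ≤ v) : iIndepFun (fun i y => canonicalObs U y i) (obsLaw 0 v) :=
  (hasGaussianLaw_canonicalObs U v).iIndepFun_of_covariance_eq_zero fun i j hij => by
    rw [cov_canonicalObs hU hv, if_neg hij]

lemma hasLaw_canonicalObs {n p : ℕ} {U : Matrix (Fin n) (Fin p) ℝ} (hU : Uᵀ * U = 1) {v : ℝ}
    (hv : 0 ≤ v) (i : Fin p) :
    HasLaw (fun y => canonicalObs U y i) (gaussianReal 0 v.toNNReal) (obsLaw 0 v) := by
  refine ⟨(measurable_canonicalObs_apply U i).aemeasurable, ?_⟩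
  have hG := (hasGaussianLaw_canonicalObs U v).eval i
  rw [hG.map_eq_gaussianReal, ← covariance_self hG.aemeasurable, cov_canonicalObs hU hv, if_pos rfl]
  congr 1
  simp_rw [canonicalObs_apply]
  have := (innerSL ℝ (column U i)).integral_comp_id_comm
    (μ := obsLaw (0 : EuclideanSpace ℝ (Fin n)) v) IsGaussian.integrable_id
  simp only [innerSL_apply_apply] at this
  rw [this, obsLaw, integral_id_multivariateGaussian, inner_zero_right]

/-! ### Gaussian moments. -/

/-- The fourth central moment constant `E (X² - v)²` of `X ∼ N(0, v)`. -/
def chiVar (v : ℝ) : ℝ := ∫ x, (x ^ 2 - v) ^ 2 ∂(gaussianReal 0 v.toNNReal)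

lemma chiVar_nonneg (v : ℝ) : 0 ≤ chiVar v := integral_nonneg fun _ => sq_nonneg _

section Moments

variable {Ω : Type*} [MeasurableSpace Ω] {P : Measure Ω} {X : Ω → ℝ} {v : ℝ}

lemma _root_.ProbabilityTheory.HasLaw.memLp_gaussian (h : HasLaw X (gaussianReal 0 v.toNNReal) P) {q : ℝ≥0∞} (hq : q ≠ ∞) :
    MemLp X q P := h.hasGaussianLaw.memLp hq

lemma _root_.ProbabilityTheory.HasLaw.integral_gaussian (h : HasLaw X (gaussianReal 0 v.toNNReal) P) :
    ∫ ω, X ω ∂P = 0 := by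
  have := h.integral_comp (f := fun x => x) aestronglyMeasurable_id
  rw [integral_id_gaussianReal] at this
  exact this

lemma _root_.ProbabilityTheory.HasLaw.integral_sq_gaussian (hv : 0 ≤ v) (h : HasLaw X (gaussianReal 0 v.toNNReal) P) :
    ∫ ω, X ω ^ 2 ∂P = v := by
  have h1 := h.integral_comp (f := fun x => x ^ 2) (by fun_prop)
  have h2 := variance_of_integral_eq_zero (μ := gaussianReal 0 v.toNNReal) (X := fun x => x)
    aemeasurable_id integral_id_gaussianReal
  rw [variance_fun_id_gaussianReal, Real.coe_toNNReal _ hv] at h2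
  rw [h2]
  exact h1

lemma _root_.ProbabilityTheory.HasLaw.memLp_sq_sub (h : HasLaw X (gaussianReal 0 v.toNNReal) P) :
    MemLp (fun ω => X ω ^ 2 - v) 2 P := by
  have := h.isProbabilityMeasure
  refine MemLp.sub ?_ (memLp_const v)
  have h4 : MemLp X 4 P := h.memLp_gaussian (by simp)
  have hmul : MemLp (fun ω => X ω * X ω) 2 P :=
    h4.mul' (hpqr := ⟨by
      rw [← two_mul]
      have : (4 : ℝ≥0∞) = 2 * 2 := by norm_num
      rw [this, ENNReal.mul_inv (by simp) (by simp), ← mul_assoc,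
        ENNReal.mul_inv_cancel (by simp) (by simp), one_mul]⟩) h4
  simpa [sq] using hmul

lemma _root_.ProbabilityTheory.HasLaw.integral_sq_sub (hv : 0 ≤ v) (h : HasLaw X (gaussianReal 0 v.toNNReal) P) :
    ∫ ω, (X ω ^ 2 - v) ∂P = 0 := by
  have := h.isProbabilityMeasure
  rw [integral_sub (h.memLp_gaussian (by simp)).integrable_sq (integrable_const _),
    h.integral_sq_gaussian hv]
  simp

lemma _root_.ProbabilityTheory.HasLaw.integral_sq_sub_sq (h : HasLaw X (gaussianReal 0 v.toNNReal) P) :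
    ∫ ω, (X ω ^ 2 - v) ^ 2 ∂P = chiVar v :=
  h.integral_comp (f := fun x => (x ^ 2 - v) ^ 2) (by fun_prop)

end Moments

/-! ### Upper bounds: the linear Pinsker rule and the adaptive rule. -/

section Upper

variable {n p : ℕ} {U : Matrix (Fin n) (Fin p) ℝ} {v : ℝ}

lemma integral_linear_loss (hU : Uᵀ * U = 1) (hv : 0 ≤ v) (f ξ : Fin p → ℝ) :
    Integrable (fun ω => ∑ i, (f i * (ξ i + canonicalObs U ω i) - ξ i) ^ 2) (obsLaw 0 v) ∧
    ∫ ω, ∑ i, (f i * (ξ i + canonicalObs U ω i) - ξ i) ^ 2 ∂(obsLaw 0 v) =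
      ∑ i, (f i ^ 2 * v + (1 - f i) ^ 2 * ξ i ^ 2) := by
  have hL := fun i => hasLaw_canonicalObs hU hv i
  have hexp : ∀ i ω, (f i * (ξ i + canonicalObs U ω i) - ξ i) ^ 2 =
      f i ^ 2 * canonicalObs U ω i ^ 2 - 2 * f i * (1 - f i) * ξ i * canonicalObs U ω i +
        (1 - f i) ^ 2 * ξ i ^ 2 := fun i ω => by ring
  have i1 : ∀ i, Integrable (fun ω => f i ^ 2 * canonicalObs U ω i ^ 2) (obsLaw 0 v) := fun i =>
    ((hL i).memLp_gaussian (by simp)).integrable_sq.const_mul _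
  have i2 : ∀ i, Integrable (fun ω => 2 * f i * (1 - f i) * ξ i * canonicalObs U ω i)
      (obsLaw 0 v) := fun i =>
    (((hL i).memLp_gaussian (q := 1) (by simp)).integrable le_rfl).const_mul _
  have hi : ∀ i, Integrable (fun ω => (f i * (ξ i + canonicalObs U ω i) - ξ i) ^ 2)
      (obsLaw 0 v) := fun i => by
    simp_rw [hexp]
    exact ((i1 i).sub (i2 i)).add (integrable_const _)
  refine ⟨integrable_finsetSum _ fun i _ => hi i, ?_⟩
  rw [integral_finsetSum _ fun i _ => hi i]
  refine Finset.sum_congr rfl fun i _ => ?_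
  have i3 : Integrable (fun ω => f i ^ 2 * canonicalObs U ω i ^ 2 -
      2 * f i * (1 - f i) * ξ i * canonicalObs U ω i) (obsLaw 0 v) := (i1 i).sub (i2 i)
  simp_rw [hexp]
  rw [integral_add i3 (integrable_const _), integral_sub (i1 i) (i2 i),
    integral_const_mul, integral_const_mul, (hL i).integral_sq_gaussian hv,
    (hL i).integral_gaussian]
  simp

lemma lintegral_linear_loss (hU : Uᵀ * U = 1) (hv : 0 ≤ v) (f ξ : Fin p → ℝ) :
    ∫⁻ y, ENNReal.ofReal (∑ i, (f i * canonicalObs U y i - ξ i) ^ 2) ∂(obsLaw (meanOf U ξ) v) =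
      ENNReal.ofReal (∑ i, (f i ^ 2 * v + (1 - f i) ^ 2 * ξ i ^ 2)) := by
  obtain ⟨h1, h2⟩ := integral_linear_loss hU hv f ξ
  have hm : Measurable fun y => ENNReal.ofReal (∑ i, (f i * canonicalObs U y i - ξ i) ^ 2) := by
    have := measurable_canonicalObs_apply U
    fun_prop
  rw [obsLaw_eq_map, lintegral_map hm (by fun_prop), ← h2, ofReal_integral_eq_lintegral_ofReal h1
    (ae_of_all _ fun ω => Finset.sum_nonneg fun i _ => sq_nonneg _)]
  simp_rw [canonicalObs_add, canonicalObs_meanOf hU]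

lemma norm_msEstimator_sub_sq (hU : Uᵀ * U = 1) (fh : EuclideanSpace ℝ (Fin n) → Fin p → ℝ)
    (ξ : Fin p → ℝ) (y : EuclideanSpace ℝ (Fin n)) :
    ‖msEstimator U fh y - meanOf U ξ‖ ^ 2 = ∑ i, (fh y i * canonicalObs U y i - ξ i) ^ 2 :=
  norm_meanOf_sub_sq hU _ _

lemma risk_linear (hU : Uᵀ * U = 1) (hp : 0 < p) (hv : 0 ≤ v) (f ξ : Fin p → ℝ) :
    risk p (msEstimator U fun _ => f) (meanOf U ξ) v =
      ENNReal.ofReal ((∑ i, (f i ^ 2 * v + (1 - f i) ^ 2 * ξ i ^ 2)) / p) := by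
  simp_rw [risk, norm_msEstimator_sub_sq hU]
  rw [lintegral_linear_loss hU hv, ENNReal.ofReal_div_of_pos (by exact_mod_cast hp),
    ENNReal.ofReal_natCast]

lemma measurable_msEstimator {fh : EuclideanSpace ℝ (Fin n) → Fin p → ℝ} (h : Measurable fh) :
    Measurable (msEstimator U fh) := by
  refine (continuous_meanOf U).measurable.comp (measurable_pi_lambda _ fun i => ?_)
  exact ((measurable_pi_apply i).comp h).mul (measurable_canonicalObs_apply U i)

/-- The Pinsker value is an upper bound for the minimax risk. -/
theorem minimaxRisk_le_pinskerValue (hU : Uᵀ * U = 1) (hp : 0 < p) {a : Fin p → ℝ≥0∞}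
    (ha : ∀ i, 1 ≤ a i) {r : ℝ} (hr : 0 < r) (hv : 0 < v) (hex : ∃ γ, IsPinskerLevel r a v γ) :
    minimaxRisk U r a v ≤ ENNReal.ofReal (pinskerValue r a v) := by
  refine iInf₂_le_of_le (msEstimator U fun _ => pinskerFilter a (pinskerLevel r a v))
    (measurable_msEstimator measurable_const) (iSup₂_le fun ξ hξ => ?_)
  rw [risk_linear hU hp hv.le]
  exact ENNReal.ofReal_le_ofReal (pinskerFilter_risk_le hp ha hr hv hex hξ)

/-- The noise terms in the comparison of the estimated and the actual loss are small, uniformly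
over bounded sets of mean vectors. -/
lemma integral_runMax_noise_le (hU : Uᵀ * U = 1) (hp : 0 < p) (hv : 0 ≤ v) {B : ℝ}
    {ξ : Fin p → ℝ} (hξ : ∑ i, ξ i ^ 2 ≤ p * B) :
    Integrable (fun ω => runMax (partialSum fun i =>
      (ξ i + canonicalObs U ω i) * canonicalObs U ω i - v) p) (obsLaw 0 v) ∧
    ∫ ω, runMax (partialSum fun i => (ξ i + canonicalObs U ω i) * canonicalObs U ω i - v) p
      ∂(obsLaw 0 v) ≤ Real.sqrt p * (1 / 2 + 4 * (v * B + chiVar v)) := by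
  have hL := fun i => hasLaw_canonicalObs hU hv i
  set X : Fin p → EuclideanSpace ℝ (Fin n) → ℝ := fun i ω =>
    (ξ i + canonicalObs U ω i) * canonicalObs U ω i - v with hX
  -- The noise splits into a linear and a quadratic part, both centred.
  have hexp : ∀ i ω, X i ω = ξ i * canonicalObs U ω i + (canonicalObs U ω i ^ 2 - v) :=
    fun i ω => by simp only [hX]; ring
  have h2 : ∀ i, MemLp (X i) 2 (obsLaw 0 v) := fun i => by
    rw [funext (hexp i)]
    exact (((hL i).memLp_gaussian (by simp)).const_mul (ξ i)).add (hL i).memLp_sq_sub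
  have hm : ∀ i, Measurable (X i) := fun i => by
    have := measurable_canonicalObs_apply U i
    simp only [hX]
    fun_prop
  have hind : iIndepFun X (obsLaw 0 v) :=
    (iIndepFun_canonicalObs hU hv).comp (fun i x => (ξ i + x) * x - v) fun i => by fun_prop
  have h0 : ∀ i, ∫ ω, X i ω ∂(obsLaw 0 v) = 0 := fun i => by
    simp_rw [hexp]
    rw [integral_add (((hL i).memLp_gaussian (q := 1) (by simp)).integrable le_rfl |>.const_mul _)
      ((hL i).memLp_sq_sub.integrable (by norm_num)), integral_const_mul,
      (hL i).integral_gaussian, (hL i).integral_sq_sub hv]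
    simp
  have hsq : ∀ i, ∫ ω, X i ω ^ 2 ∂(obsLaw 0 v) ≤ 2 * v * ξ i ^ 2 + 2 * chiVar v := fun i => by
    have i1 := ((hL i).memLp_gaussian (q := 2) (by simp)).integrable_sq.const_mul (2 * ξ i ^ 2)
    have i2 := (hL i).memLp_sq_sub.integrable_sq.const_mul 2
    calc ∫ ω, X i ω ^ 2 ∂(obsLaw 0 v)
        ≤ ∫ ω, (2 * ξ i ^ 2 * canonicalObs U ω i ^ 2 +
          2 * (canonicalObs U ω i ^ 2 - v) ^ 2) ∂(obsLaw 0 v) := by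
          refine integral_mono (h2 i).integrable_sq (i1.add i2) fun ω => ?_
          simp only [hexp]
          nlinarith [sq_nonneg (ξ i * canonicalObs U ω i - (canonicalObs U ω i ^ 2 - v))]
      _ = _ := by
          rw [integral_add i1 i2, integral_const_mul, integral_const_mul,
            (hL i).integral_sq_gaussian hv, (hL i).integral_sq_sub_sq]
          ring
  have hsum : ∑ i, ∫ ω, X i ω ^ 2 ∂(obsLaw 0 v) ≤ p * (2 * (v * B + chiVar v)) := by
    refine (Finset.sum_le_sum fun i _ => hsq i).trans ?_
    rw [Finset.sum_add_distrib, ← Finset.mul_sum, Finset.sum_const, Finset.card_univ,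
      Fintype.card_fin, nsmul_eq_mul]
    nlinarith
  have hmax := (integral_runMax_sq_le hm hind h2 h0).trans
    (mul_le_mul_of_nonneg_left hsum (by norm_num))
  have hmem := memLp_runMax h2 p
  refine ⟨hmem.integrable (by norm_num), ?_⟩
  have hp' : (0 : ℝ) < p := by exact_mod_cast hp
  have hs : 0 < Real.sqrt p := Real.sqrt_pos.2 hp'
  have hss : Real.sqrt p * Real.sqrt p = p := Real.mul_self_sqrt hp'.le
  -- First from second moment through `m ≤ √p / 2 + m² / (2 √p)`, balanced at the true order `√p`.
  calc ∫ ω, runMax (partialSum fun i => X i ω) p ∂(obsLaw 0 v)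
      ≤ ∫ ω, (Real.sqrt p / 2 + 1 / (2 * Real.sqrt p) *
          runMax (partialSum fun i => X i ω) p ^ 2) ∂(obsLaw 0 v) := by
        refine integral_mono (hmem.integrable (by norm_num))
          ((integrable_const _).add (hmem.integrable_sq.const_mul _)) fun ω => ?_
        simp only
        generalize runMax (partialSum fun i => X i ω) p = m
        have : Real.sqrt p / 2 + 1 / (2 * Real.sqrt p) * m ^ 2 - m =
            (Real.sqrt p - m) ^ 2 / (2 * Real.sqrt p) := by field_simp; ring
        have h3 : 0 ≤ (Real.sqrt p - m) ^ 2 / (2 * Real.sqrt p) := by positivity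
        linarith
    _ = Real.sqrt p / 2 + 1 / (2 * Real.sqrt p) *
          ∫ ω, runMax (partialSum fun i => X i ω) p ^ 2 ∂(obsLaw 0 v) := by
        rw [integral_add (integrable_const _) (hmem.integrable_sq.const_mul _),
          integral_const_mul]
        simp
    _ ≤ Real.sqrt p / 2 + 1 / (2 * Real.sqrt p) *
          (4 * (Real.sqrt p * Real.sqrt p * (2 * (v * B + chiVar v)))) := by
        rw [hss]
        have : 0 ≤ 1 / (2 * Real.sqrt p) := by positivity
        gcongr
    _ = Real.sqrt p * (1 / 2 + 4 * (v * B + chiVar v)) := by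
        field_simp

/-- The oracle inequality for the risk of the adaptive estimator. -/
theorem risk_msEstimator_le (hU : Uᵀ * U = 1) (hp : 0 < p) {a : Fin p → ℝ≥0∞}
    (ha : ∀ i, 1 ≤ a i) (hmono : Monotone a) {r : ℝ} (hr : 0 < r) (hv : 0 < v)
    (hex : ∃ γ, IsPinskerLevel r a v γ) {s : EuclideanSpace ℝ (Fin n) → ℝ}
    {fh : EuclideanSpace ℝ (Fin n) → Fin p → ℝ} (hfh : IsAdaptiveShrinkage U s fh)
    {ξ : Fin p → ℝ} (hξ : ξ ∈ ellipsoid r a v) :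
    risk p (msEstimator U fh) (meanOf U ξ) v ≤ ENNReal.ofReal (pinskerValue r a v) +
      ENNReal.ofReal ((2 + 16 * (v * (v * r) + chiVar v)) / Real.sqrt p) +
      2 * varianceError s (meanOf U ξ) v := by
  have hp' : (0 : ℝ) < p := by exact_mod_cast hp
  set f := pinskerFilter a (pinskerLevel r a v) with hf
  have hfm : f ∈ monotoneClass p :=
    pinskerFilter_mem_monotoneClass ha hmono (isPinskerLevel_pinskerLevel hex).1
  set M : EuclideanSpace ℝ (Fin n) → ℝ := fun y => runMax (partialSum fun i =>
    canonicalObs U y i * (canonicalObs U y i - ξ i) - v) p with hM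
  have hMm : Measurable M := by
    refine (continuous_runMax_partialSum p).measurable.comp (measurable_pi_lambda _ fun i => ?_)
    have := measurable_canonicalObs_apply U i
    fun_prop
  have hAm : Measurable fun y => ENNReal.ofReal (∑ i, (f i * canonicalObs U y i - ξ i) ^ 2) := by
    have := measurable_canonicalObs_apply U
    fun_prop
  obtain ⟨hint, hle⟩ := integral_runMax_noise_le hU hp hv.le
    (sum_sq_le_of_mem_ellipsoid hp ha hr hv hξ)
  have hMint : ∫⁻ y, ENNReal.ofReal (M y) ∂(obsLaw (meanOf U ξ) v) ≤
      ENNReal.ofReal (Real.sqrt p * (1 / 2 + 4 * (v * (v * r) + chiVar v))) := by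
    rw [obsLaw_eq_map, lintegral_map hMm.ennreal_ofReal (by fun_prop)]
    refine le_trans (le_of_eq ?_) (ENNReal.ofReal_le_ofReal hle)
    rw [ofReal_integral_eq_lintegral_ofReal hint (ae_of_all _ fun ω => runMax_nonneg _ _)]
    simp only [hM, canonicalObs_add, canonicalObs_meanOf hU, add_sub_cancel_left]
  -- The bound is pointwise and its first two terms are measurable, so it integrates term by term
  -- without measurability of `fh` or `s`.
  have hpt : ∀ y, ENNReal.ofReal (‖msEstimator U fh y - meanOf U ξ‖ ^ 2) ≤
      ENNReal.ofReal (∑ i, (f i * canonicalObs U y i - ξ i) ^ 2) + 4 * ENNReal.ofReal (M y) +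
        (2 * p) * ENNReal.ofReal |s y - v| := fun y => by
    have h := (hfh.isRiskMinimizer hp y).loss_le hfm ξ v
    rw [norm_msEstimator_sub_sq hU]
    refine (ENNReal.ofReal_le_ofReal h).trans (le_of_eq ?_)
    have hM0 : 0 ≤ M y := runMax_nonneg _ _
    have hA0 : 0 ≤ ∑ i, (f i * canonicalObs U y i - ξ i) ^ 2 :=
      Finset.sum_nonneg fun i _ => sq_nonneg _
    rw [ENNReal.ofReal_add (by positivity) (by positivity),
      ENNReal.ofReal_add hA0 (by positivity), ENNReal.ofReal_mul (by norm_num),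
      ENNReal.ofReal_mul (by norm_num), ENNReal.ofReal_mul hp'.le, ENNReal.ofReal_natCast,
      ← mul_assoc, ENNReal.ofReal_ofNat, ENNReal.ofReal_ofNat]
  have hpe : (p : ℝ≥0∞) ≠ 0 := by exact_mod_cast hp.ne'
  have hpt' : (p : ℝ≥0∞) ≠ ∞ := ENNReal.natCast_ne_top p
  calc risk p (msEstimator U fh) (meanOf U ξ) v
      ≤ (ENNReal.ofReal (∑ i, (f i ^ 2 * v + (1 - f i) ^ 2 * ξ i ^ 2)) +
          4 * ENNReal.ofReal (Real.sqrt p * (1 / 2 + 4 * (v * (v * r) + chiVar v))) +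
          2 * p * varianceError s (meanOf U ξ) v) / p := by
        refine ENNReal.div_le_div_right ?_ _
        refine (lintegral_mono hpt).trans ?_
        have hAM : Measurable fun y => ENNReal.ofReal
            (∑ i, (f i * canonicalObs U y i - ξ i) ^ 2) + 4 * ENNReal.ofReal (M y) :=
          hAm.add (hMm.ennreal_ofReal.const_mul 4)
        rw [lintegral_add_left hAM,
          lintegral_add_left hAm, lintegral_const_mul _ hMm.ennreal_ofReal,
          lintegral_const_mul' _ _ (ENNReal.mul_ne_top (by simp) hpt'),
          lintegral_linear_loss hU hv.le]
        gcongr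
        exact le_rfl
    _ = ENNReal.ofReal ((∑ i, (f i ^ 2 * v + (1 - f i) ^ 2 * ξ i ^ 2)) / p) +
          ENNReal.ofReal ((2 + 16 * (v * (v * r) + chiVar v)) / Real.sqrt p) +
          2 * varianceError s (meanOf U ξ) v := by
        rw [ENNReal.add_div, ENNReal.add_div]
        congr 1
        · congr 1
          · rw [ENNReal.ofReal_div_of_pos hp', ENNReal.ofReal_natCast]
          · have h4 : (4 : ℝ≥0∞) = ENNReal.ofReal 4 := by norm_num
            rw [h4, ← ENNReal.ofReal_mul (by norm_num), ← ENNReal.ofReal_natCast,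
              ← ENNReal.ofReal_div_of_pos hp']
            congr 1
            have hss : Real.sqrt p * Real.sqrt p = p := Real.mul_self_sqrt hp'.le
            have hs : 0 < Real.sqrt p := Real.sqrt_pos.2 hp'
            rw [div_eq_div_iff hp'.ne' hs.ne']
            linear_combination (2 + 16 * (v * (v * r) + chiVar v)) * hss
        · rw [mul_right_comm, ENNReal.mul_div_cancel_right hpe hpt']
    _ ≤ _ := by
        gcongr
        exact pinskerFilter_risk_le hp ha hr hv hex hξ

end Upper

/-! ### The Bayes model with independent Gaussian coordinates. -/

/-- The joint law of a standard Gaussian vector and the observation noise. -/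
def jointLaw (p n : ℕ) (v : ℝ) :
    Measure (EuclideanSpace ℝ (Fin p) × EuclideanSpace ℝ (Fin n)) :=
  (obsLaw (0 : EuclideanSpace ℝ (Fin p)) 1).prod (obsLaw (0 : EuclideanSpace ℝ (Fin n)) v)

instance (p n : ℕ) (v : ℝ) : IsGaussian (jointLaw p n v) := by
  unfold jointLaw; infer_instance

lemma memLp_inner_obsLaw {n : ℕ} (x : EuclideanSpace ℝ (Fin n)) (v : ℝ) :
    MemLp (fun u => inner ℝ x u) 2 (obsLaw 0 v) :=
  (innerSL ℝ x).comp_memLp' IsGaussian.memLp_two_id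

/-- The Bayes error and every linear form of the observation have this shape, so one covariance
formula serves them all. -/
lemma cov_jointLaw {p n : ℕ} {v : ℝ} (hv : 0 ≤ v) (x x' : EuclideanSpace ℝ (Fin p))
    (w w' : EuclideanSpace ℝ (Fin n)) :
    cov[fun ω => inner ℝ x ω.1 + inner ℝ w ω.2, fun ω => inner ℝ x' ω.1 + inner ℝ w' ω.2;
      jointLaw p n v] = inner ℝ x x' + v * inner ℝ w w' := by
  have m1 : ∀ x : EuclideanSpace ℝ (Fin p),
      MemLp (fun ω : _ × _ => inner ℝ x ω.1) 2 (jointLaw p n v) := fun x =>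
    (memLp_inner_obsLaw x 1).comp_fst _
  have m2 : ∀ x : EuclideanSpace ℝ (Fin n),
      MemLp (fun ω : _ × _ => inner ℝ x ω.2) 2 (jointLaw p n v) := fun x =>
    (memLp_inner_obsLaw x v).comp_snd _
  have e1 : cov[fun ω => inner ℝ x ω.1, fun ω => inner ℝ x' ω.1; jointLaw p n v] =
      inner ℝ x x' := by
    have := covariance_map_fun (μ := jointLaw p n v) (Z := Prod.fst)
      (X := fun u => inner ℝ x u) (Y := fun u => inner ℝ x' u)
      (Measurable.aestronglyMeasurable (by fun_prop))
      (Measurable.aestronglyMeasurable (by fun_prop)) (by fun_prop)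
    rw [← this, jointLaw, measurePreserving_fst.map_eq, cov_inner_obsLaw zero_le_one, one_mul]
  have e2 : cov[fun ω => inner ℝ w ω.2, fun ω => inner ℝ w' ω.2; jointLaw p n v] =
      v * inner ℝ w w' := by
    have := covariance_map_fun (μ := jointLaw p n v) (Z := Prod.snd)
      (X := fun u => inner ℝ w u) (Y := fun u => inner ℝ w' u)
      (Measurable.aestronglyMeasurable (by fun_prop))
      (Measurable.aestronglyMeasurable (by fun_prop)) (by fun_prop)
    rw [← this, jointLaw, measurePreserving_snd.map_eq, cov_inner_obsLaw hv]
  have e3 : ∀ (x : EuclideanSpace ℝ (Fin p)) (w : EuclideanSpace ℝ (Fin n)),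
      cov[fun ω => inner ℝ x ω.1, fun ω => inner ℝ w ω.2; jointLaw p n v] = 0 := fun x w =>
    covariance_fst_snd_prod (memLp_inner_obsLaw x 1) (memLp_inner_obsLaw w v)
  have a1 := covariance_add_left (m1 x) (m2 w) ((m1 x').add (m2 w'))
  have a2 := covariance_add_right (m1 x) (m1 x') (m2 w')
  have a3 := covariance_add_right (m2 w) (m1 x') (m2 w')
  have e4 := e3 x' w
  rw [covariance_comm] at e4
  rw [a2, a3, e1, e2, e3, e4] at a1
  refine Eq.trans a1 ?_
  ring

lemma integral_inner_jointLaw {p n : ℕ} (v : ℝ) (x : EuclideanSpace ℝ (Fin p))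
    (w : EuclideanSpace ℝ (Fin n)) :
    ∫ ω, (inner ℝ x ω.1 + inner ℝ w ω.2) ∂(jointLaw p n v) = 0 := by
  have h : ∀ {k : ℕ} (u : EuclideanSpace ℝ (Fin k)) (c : ℝ),
      ∫ y, inner ℝ u y ∂(obsLaw 0 c) = 0 := fun u c => by
    have := (innerSL ℝ u).integral_comp_id_comm (μ := obsLaw 0 c) IsGaussian.integrable_id
    simp only [innerSL_apply_apply] at this
    rw [this, obsLaw, integral_id_multivariateGaussian, inner_zero_right]
  have i1 : Integrable (fun ω : _ × _ => inner ℝ x ω.1) (jointLaw p n v) :=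
    ((memLp_inner_obsLaw x 1).comp_fst _).integrable (by norm_num)
  have i2 : Integrable (fun ω : _ × _ => inner ℝ w ω.2) (jointLaw p n v) :=
    ((memLp_inner_obsLaw w v).comp_snd _).integrable (by norm_num)
  rw [integral_add i1 i2, jointLaw, integral_fun_fst, integral_fun_snd, h, h]
  simp

section Bayes

variable {n p : ℕ} (U : Matrix (Fin n) (Fin p) ℝ) (v : ℝ) (τ : Fin p → ℝ)

/-- The random mean vector `ξ i = τ i g i`. -/
def priorMean (g : EuclideanSpace ℝ (Fin p)) (i : Fin p) : ℝ := τ i * g i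

/-- The observation in the Bayes model. -/
def bayesObs (ω : EuclideanSpace ℝ (Fin p) × EuclideanSpace ℝ (Fin n)) :
    EuclideanSpace ℝ (Fin n) := meanOf U (priorMean τ ω.1) + ω.2

/-- The Bayes shrinkage factor. -/
def bayesFactor (i : Fin p) : ℝ := τ i ^ 2 / (v + τ i ^ 2)

/-- The posterior error of the Bayes rule. -/
def bayesError (i : Fin p) (ω : EuclideanSpace ℝ (Fin p) × EuclideanSpace ℝ (Fin n)) : ℝ :=
  priorMean τ ω.1 i - bayesFactor v τ i * canonicalObs U (bayesObs U τ ω) i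

variable {U v τ}

lemma continuous_bayesObs : Continuous (bayesObs U τ) := by
  unfold bayesObs priorMean
  have := continuous_meanOf U
  fun_prop

lemma canonicalObs_bayesObs (hU : Uᵀ * U = 1)
    (ω : EuclideanSpace ℝ (Fin p) × EuclideanSpace ℝ (Fin n)) (i : Fin p) :
    canonicalObs U (bayesObs U τ ω) i = τ i * ω.1 i + canonicalObs U ω.2 i := by
  rw [bayesObs, canonicalObs_add, canonicalObs_meanOf hU, priorMean]

lemma bayesError_eq (hU : Uᵀ * U = 1) (i : Fin p)
    (ω : EuclideanSpace ℝ (Fin p) × EuclideanSpace ℝ (Fin n)) :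
    bayesError U v τ i ω =
      inner ℝ (EuclideanSpace.single i ((1 - bayesFactor v τ i) * τ i)) ω.1 +
        inner ℝ (-bayesFactor v τ i • column U i) ω.2 := by
  rw [bayesError, canonicalObs_bayesObs hU, EuclideanSpace.inner_single_left, inner_smul_left,
    ← canonicalObs_apply, priorMean]
  simp
  ring

lemma inner_bayesObs (t : EuclideanSpace ℝ (Fin n))
    (ω : EuclideanSpace ℝ (Fin p) × EuclideanSpace ℝ (Fin n)) :
    inner ℝ t (bayesObs U τ ω) =
      inner ℝ (WithLp.toLp 2 fun j => τ j * inner ℝ t (column U j) : EuclideanSpace ℝ (Fin p)) ω.1 +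
        inner ℝ t ω.2 := by
  rw [bayesObs, inner_add_right, meanOf_eq_sum, inner_sum]
  congr 1
  rw [PiLp.inner_apply]
  refine Finset.sum_congr rfl fun i _ => ?_
  rw [inner_smul_right]
  simp [priorMean]
  ring

lemma hasGaussianLaw_bayes (hU : Uᵀ * U = 1) (i : Fin p) :
    HasGaussianLaw (fun ω => (bayesError U v τ i ω, bayesObs U τ ω)) (jointLaw p n v) := by
  set L₁ : (EuclideanSpace ℝ (Fin p) × EuclideanSpace ℝ (Fin n)) →L[ℝ] ℝ :=
    (innerSL ℝ (EuclideanSpace.single i ((1 - bayesFactor v τ i) * τ i))).comp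
      (ContinuousLinearMap.fst ℝ _ _) + (innerSL ℝ (-bayesFactor v τ i • column U i)).comp
      (ContinuousLinearMap.snd ℝ _ _) with hL₁
  set L₂ : (EuclideanSpace ℝ (Fin p) × EuclideanSpace ℝ (Fin n)) →L[ℝ] EuclideanSpace ℝ (Fin n) :=
    ∑ j, ((innerSL ℝ (EuclideanSpace.single j (τ j))).comp
      (ContinuousLinearMap.fst ℝ _ _)).smulRight (column U j) +
      ContinuousLinearMap.snd ℝ _ _ with hL₂
  have h := (IsGaussian.hasGaussianLaw_id (μ := jointLaw p n v)).map (L₁.prod L₂)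
  have he : (fun ω => (bayesError U v τ i ω, bayesObs U τ ω)) = (L₁.prod L₂) ∘ id := by
    funext ω
    refine Prod.ext ?_ ?_
    · rw [bayesError_eq hU]
      simp [hL₁, inner_smul_left]
    · simp [hL₂, bayesObs, meanOf_eq_sum, priorMean, EuclideanSpace.inner_single_left]
  rw [he]
  exact h

/-- With `c = τ² / (v + τ²)`, the covariance with any linear form of `y` is a multiple of `(1 - c)
τ² - c v = 0`; joint Gaussianity upgrades this to independence of the full observation, including
its part outside the regression space. -/
lemma indepFun_bayesError (hU : Uᵀ * U = 1) (hv : 0 < v) (i : Fin p) :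
    IndepFun (bayesError U v τ i) (bayesObs U τ) (jointLaw p n v) := by
  refine (hasGaussianLaw_bayes hU i).indepFun_of_covariance_inner fun x t => ?_
  have h1 : (fun ω => inner ℝ x (bayesError U v τ i ω)) = fun ω => x * bayesError U v τ i ω := by
    funext ω
    simp [mul_comm]
  refine (congrArg (fun f => cov[f, fun ω => inner ℝ t (bayesObs U τ ω); jointLaw p n v])
    h1).trans ?_
  rw [covariance_const_mul_left]
  rw [funext (bayesError_eq hU i), funext (inner_bayesObs t), cov_jointLaw hv.le, EuclideanSpace.inner_single_left, inner_smul_left,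
    real_inner_comm t (column U i)]
  have : v + τ i ^ 2 ≠ 0 := by positivity
  simp only [bayesFactor, conj_trivial]
  field_simp
  ring

lemma integral_bayesError_sq (hU : Uᵀ * U = 1) (hv : 0 < v) (i : Fin p) :
    ∫ ω, bayesError U v τ i ω ^ 2 ∂(jointLaw p n v) = v * τ i ^ 2 / (v + τ i ^ 2) := by
  have h0 : ∫ ω, bayesError U v τ i ω ∂(jointLaw p n v) = 0 := by
    simp_rw [bayesError_eq hU]
    exact integral_inner_jointLaw _ _ _
  have hm := (hasGaussianLaw_bayes (τ := τ) (v := v) hU i).fst.aemeasurable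
  rw [← variance_of_integral_eq_zero hm h0, ← covariance_self hm, funext (bayesError_eq hU i),
    cov_jointLaw hv.le, EuclideanSpace.inner_single_left, inner_smul_left, inner_smul_right,
    inner_column hU]
  have : v + τ i ^ 2 ≠ 0 := by positivity
  simp [bayesFactor]
  field_simp
  ring

lemma memLp_priorMean (i : Fin p) :
    MemLp (fun ω : _ × EuclideanSpace ℝ (Fin n) => priorMean τ ω.1 i) 2 (jointLaw p n v) := by
  have h := ((memLp_inner_obsLaw (EuclideanSpace.single i (τ i)) 1).comp_fst
    (obsLaw (0 : EuclideanSpace ℝ (Fin n)) v))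
  simp only [EuclideanSpace.inner_single_left, conj_trivial] at h
  exact h

/-- The Bayes risk in one coordinate. -/
theorem bayesRisk_le (hU : Uᵀ * U = 1) (hv : 0 < v) (i : Fin p)
    {d : EuclideanSpace ℝ (Fin n) → ℝ} (hd : Measurable d) {K : ℝ} (hK : ∀ y, |d y| ≤ K) :
    Integrable (fun ω => (d (bayesObs U τ ω) - priorMean τ ω.1 i) ^ 2) (jointLaw p n v) ∧
    v * τ i ^ 2 / (v + τ i ^ 2) ≤
      ∫ ω, (d (bayesObs U τ ω) - priorMean τ ω.1 i) ^ 2 ∂(jointLaw p n v) := by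
  have hY := (continuous_bayesObs (U := U) (τ := τ)).measurable
  have m1 : MemLp (fun ω => d (bayesObs U τ ω)) 2 (jointLaw p n v) :=
    MemLp.of_bound (hd.comp hY).aestronglyMeasurable K (ae_of_all _ fun ω => hK _)
  have m2 := memLp_priorMean (n := n) (v := v) (τ := τ) i
  have m3 : MemLp (bayesError U v τ i) 2 (jointLaw p n v) :=
    (hasGaussianLaw_bayes hU i).fst.memLp_two
  refine ⟨(m1.sub m2).integrable_sq, ?_⟩
  set h : EuclideanSpace ℝ (Fin n) → ℝ := fun y => d y - bayesFactor v τ i * canonicalObs U y i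
    with hh
  have hhm : Measurable h := hd.sub ((measurable_canonicalObs_apply U i).const_mul _)
  have he : ∀ ω, h (bayesObs U τ ω) =
      d (bayesObs U τ ω) - priorMean τ ω.1 i + bayesError U v τ i ω := fun ω => by
    simp only [hh, bayesError]; ring
  have m4 : MemLp (fun ω => h (bayesObs U τ ω)) 2 (jointLaw p n v) := by
    simp_rw [he]
    exact (m1.sub m2).add m3
  have hI : IndepFun (bayesError U v τ i) (fun ω => h (bayesObs U τ ω)) (jointLaw p n v) :=
    (indepFun_bayesError hU hv i).comp measurable_id hhm
  have h0 : ∫ ω, bayesError U v τ i ω ∂(jointLaw p n v) = 0 := by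
    simp_rw [bayesError_eq hU]
    exact integral_inner_jointLaw _ _ _
  have hz : ∫ ω, bayesError U v τ i ω * h (bayesObs U τ ω) ∂(jointLaw p n v) = 0 := by
    rw [hI.integral_fun_mul_eq_mul_integral m3.aestronglyMeasurable m4.aestronglyMeasurable, h0,
      zero_mul]
  have i5 : Integrable (fun ω => bayesError U v τ i ω * h (bayesObs U τ ω)) (jointLaw p n v) :=
    m3.integrable_mul m4
  rw [← integral_bayesError_sq (n := n) (U := U) (τ := τ) hU hv i]
  -- Write `e` for the Bayes error. The loss is `(h - e)² ≥ e² - 2 e h`, and the cross term has mean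
  -- zero since `h` is a function of the observation.
  calc ∫ ω, bayesError U v τ i ω ^ 2 ∂(jointLaw p n v)
      = ∫ ω, (bayesError U v τ i ω ^ 2 - 2 * (bayesError U v τ i ω * h (bayesObs U τ ω)))
          ∂(jointLaw p n v) := by
        rw [integral_sub m3.integrable_sq (i5.const_mul 2), integral_const_mul, hz]
        simp
    _ ≤ _ := by
        refine integral_mono (m3.integrable_sq.sub (i5.const_mul 2)) (m1.sub m2).integrable_sq
          fun ω => ?_
        have e2 : d (bayesObs U τ ω) - priorMean τ ω.1 i =
            h (bayesObs U τ ω) - bayesError U v τ i ω := by rw [he]; ring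
        simp only [e2]
        nlinarith [sq_nonneg (h (bayesObs U τ ω))]

end Bayes

/-! ### The lower bound: truncation and concentration of the prior. -/

section Truncation

variable {n p : ℕ} {U : Matrix (Fin n) (Fin p) ℝ}

open Classical in
/-- The canonical coordinates of an estimator, set to zero where they are too large. -/
def truncated (U : Matrix (Fin n) (Fin p) ℝ) (B : ℝ)
    (δ : EuclideanSpace ℝ (Fin n) → EuclideanSpace ℝ (Fin n)) (y : EuclideanSpace ℝ (Fin n)) :
    Fin p → ℝ :=
  if ∑ i, canonicalObs U (δ y) i ^ 2 ≤ 4 * B then canonicalObs U (δ y) else 0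

lemma measurable_truncated {δ : EuclideanSpace ℝ (Fin n) → EuclideanSpace ℝ (Fin n)}
    (hδ : Measurable δ) (B : ℝ) : Measurable (truncated U B δ) := by
  have h := (continuous_canonicalObs U).measurable.comp hδ
  have h' : ∀ i, Measurable fun y => canonicalObs U (δ y) i := fun i =>
    (measurable_pi_apply i).comp h
  refine Measurable.ite (measurableSet_le ?_ measurable_const) h measurable_const
  exact Finset.measurable_sum _ fun i _ => (h' i).pow_const 2

lemma sum_truncated_sq_le {B : ℝ} (hB : 0 ≤ B)
    (δ : EuclideanSpace ℝ (Fin n) → EuclideanSpace ℝ (Fin n)) (y : EuclideanSpace ℝ (Fin n)) :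
    ∑ i, truncated U B δ y i ^ 2 ≤ 4 * B := by
  unfold truncated
  split_ifs with h
  · exact h
  · simpa using hB

/-- If `|c|² > 4 B` and `|ξ|² ≤ B`, then `|c - ξ|² ≥ |c|² / 2 - |ξ|² > B`, which exceeds the loss
`|ξ|²` of the zero estimate. Truncation thus costs nothing on the ellipsoid and bounds the loss off
it. -/
lemma truncated_loss_le (hU : Uᵀ * U = 1) {B : ℝ}
    (δ : EuclideanSpace ℝ (Fin n) → EuclideanSpace ℝ (Fin n)) (y : EuclideanSpace ℝ (Fin n))
    {ξ : Fin p → ℝ} (hξ : ∑ i, ξ i ^ 2 ≤ B) :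
    ∑ i, (truncated U B δ y i - ξ i) ^ 2 ≤ ‖δ y - meanOf U ξ‖ ^ 2 := by
  refine le_trans ?_ (sum_sq_canonicalObs_sub_le hU (δ y) ξ)
  unfold truncated
  split_ifs with h
  · exact le_rfl
  · push Not at h
    generalize canonicalObs U (δ y) = c at *
    have h1 : ∑ i, (c i ^ 2 / 2 + -ξ i ^ 2) ≤ ∑ i, (c i - ξ i) ^ 2 :=
      Finset.sum_le_sum fun i _ => by nlinarith [sq_nonneg (c i - 2 * ξ i)]
    rw [Finset.sum_add_distrib, ← Finset.sum_div, Finset.sum_neg_distrib] at h1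
    simp only [Pi.zero_apply, zero_sub, neg_sq]
    linarith

end Truncation

section Lower

variable {n p : ℕ} {U : Matrix (Fin n) (Fin p) ℝ} {v r : ℝ} {a : Fin p → ℝ≥0∞}

/-- The normalized weighted sum of squares of the random mean vector. -/
def priorAve (a : Fin p → ℝ≥0∞) (τ : Fin p → ℝ) (g : EuclideanSpace ℝ (Fin p)) : ℝ :=
  (∑ i, (a i).toReal * priorMean τ g i ^ 2) / p

/-- The expectation of `priorAve`. -/
def priorLevel (a : Fin p → ℝ≥0∞) (τ : Fin p → ℝ) : ℝ := (∑ i, (a i).toReal * τ i ^ 2) / p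

/-- An average of `p` independent terms with bounded variances has variance `O(1 / p)`; this is how
the prior concentrates on the ellipsoid. -/
lemma integral_priorAve_sub_sq_le (hp : 0 < p) {τ : Fin p → ℝ} {G : ℝ}
    (hG : ∀ i, (a i).toReal * τ i ^ 2 ≤ G) :
    Integrable (fun g => (priorAve a τ g - priorLevel a τ) ^ 2) (obsLaw 0 1) ∧
    ∫ g, (priorAve a τ g - priorLevel a τ) ^ 2 ∂(obsLaw 0 1) ≤ G ^ 2 * chiVar 1 / p := by
  have hp' : (0 : ℝ) < p := by exact_mod_cast hp
  -- The standard Gaussian vector is an observation with identity design, so the results on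
  -- canonical coordinates apply.
  have hone : (1 : Matrix (Fin p) (Fin p) ℝ)ᵀ * 1 = 1 := by simp
  have hcoord : ∀ (g : EuclideanSpace ℝ (Fin p)) i, canonicalObs 1 g i = g i := fun g i => by
    simp [canonicalObs]
  have hL : ∀ i, HasLaw (fun g : EuclideanSpace ℝ (Fin p) => g i)
      (gaussianReal 0 (1 : ℝ).toNNReal) (obsLaw 0 1) := fun i => by
    simpa [hcoord] using hasLaw_canonicalObs hone zero_le_one i
  have hindg : iIndepFun (fun i (g : EuclideanSpace ℝ (Fin p)) => g i) (obsLaw 0 1) := by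
    simpa [hcoord] using iIndepFun_canonicalObs hone zero_le_one
  set c : Fin p → ℝ := fun i => (a i).toReal * τ i ^ 2 with hc
  have hc0 : ∀ i, 0 ≤ c i := fun i => mul_nonneg ENNReal.toReal_nonneg (sq_nonneg _)
  set X : Fin p → EuclideanSpace ℝ (Fin p) → ℝ := fun i g => c i * (g i ^ 2 - 1) with hX
  have hind : iIndepFun X (obsLaw 0 1) :=
    hindg.comp (fun i x => c i * (x ^ 2 - 1)) fun i => by fun_prop
  have h2 : ∀ i, MemLp (X i) 2 (obsLaw 0 1) := fun i => (hL i).memLp_sq_sub.const_mul _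
  have hm : ∀ i, Measurable (X i) := fun i => by
    simp only [hX]; fun_prop
  have h0 : ∀ i, ∫ g, X i g ∂(obsLaw 0 1) = 0 := fun i => by
    simp only [hX]
    rw [integral_const_mul, (hL i).integral_sq_sub zero_le_one, mul_zero]
  have hsq : ∀ i, ∫ g, X i g ^ 2 ∂(obsLaw 0 1) = c i ^ 2 * chiVar 1 := fun i => by
    simp only [hX, mul_pow]
    rw [integral_const_mul, (hL i).integral_sq_sub_sq]
  have hdiff : ∀ g, (priorAve a τ g - priorLevel a τ) ^ 2 =
      ((p : ℝ) ^ 2)⁻¹ * (∑ i, X i g) ^ 2 := fun g => by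
    have : ∑ i, X i g = ∑ i, (a i).toReal * priorMean τ g i ^ 2 -
        ∑ i, (a i).toReal * τ i ^ 2 := by
      rw [← Finset.sum_sub_distrib]
      exact Finset.sum_congr rfl fun i _ => by simp only [hX, hc, priorMean]; ring
    rw [this, priorAve, priorLevel]
    field_simp
  have hS : MemLp (fun g => ∑ i, X i g) 2 (obsLaw 0 1) := memLp_finsetSum _ fun i _ => h2 i
  simp_rw [hdiff]
  refine ⟨hS.integrable_sq.const_mul _, ?_⟩
  rw [integral_const_mul, integral_sum_sq hm hind h2 h0]
  simp_rw [hsq]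
  have hle : ∑ i, c i ^ 2 * chiVar 1 ≤ p * (G ^ 2 * chiVar 1) := by
    have := Finset.sum_le_card_nsmul Finset.univ (fun i => c i ^ 2 * chiVar 1) (G ^ 2 * chiVar 1)
      fun i _ => mul_le_mul_of_nonneg_right (pow_le_pow_left₀ (hc0 i) (hG i) 2) (chiVar_nonneg 1)
    simpa using this
  calc ((p : ℝ) ^ 2)⁻¹ * ∑ i, c i ^ 2 * chiVar 1 ≤ ((p : ℝ) ^ 2)⁻¹ * (p * (G ^ 2 * chiVar 1)) :=
        mul_le_mul_of_nonneg_left hle (by positivity)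
    _ = _ := by field_simp

/-- Lower bound for the maximal risk over the ellipsoid by a Bayes risk, for a Gaussian prior
whose mean lies strictly inside the ellipsoid. -/
theorem bayes_le_iSup_risk (hU : Uᵀ * U = 1) (hp : 0 < p) (ha : ∀ i, 1 ≤ a i) (hr : 0 < r)
    (hv : 0 < v) {τ : Fin p → ℝ} (hτ : ∀ i, a i = ∞ → τ i = 0) {t G : ℝ} (ht : 0 < t)
    (hlevel : priorLevel a τ + t ≤ v * r) (hG : ∀ i, (a i).toReal * τ i ^ 2 ≤ G)
    {δ : EuclideanSpace ℝ (Fin n) → EuclideanSpace ℝ (Fin n)} (hδ : Measurable δ) :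
    ENNReal.ofReal ((∑ i, v * τ i ^ 2 / (v + τ i ^ 2)) / p) ≤
      (⨆ ξ ∈ ellipsoid r a v, risk p δ (meanOf U ξ) v) +
        ENNReal.ofReal ((10 * (v * r) / t ^ 2 + 2 / t) * (G ^ 2 * chiVar 1) / p) := by
  have hp' : (0 : ℝ) < p := by exact_mod_cast hp
  have hpe : (p : ℝ≥0∞) ≠ 0 := by exact_mod_cast hp.ne'
  have hpt : (p : ℝ≥0∞) ≠ ∞ := ENNReal.natCast_ne_top p
  set R := ⨆ ξ ∈ ellipsoid r a v, risk p δ (meanOf U ξ) v with hR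
  set D : ℝ := 10 * (v * r) / t ^ 2 + 2 / t with hD
  have hD0 : 0 ≤ D := by positivity
  set B : ℝ := p * (v * r) with hB
  have hB0 : 0 ≤ B := by positivity
  set d := truncated U B δ with hd
  have hdm : Measurable d := measurable_truncated hδ B
  have hdi : ∀ i, Measurable fun y => d y i := fun i => (measurable_pi_apply i).comp hdm
  have hdK : ∀ i y, |d y i| ≤ Real.sqrt (4 * B) := fun i y => by
    refine Real.abs_le_sqrt ?_
    exact (Finset.single_le_sum (f := fun i => d y i ^ 2) (fun j _ => sq_nonneg _)
      (Finset.mem_univ i)).trans (sum_truncated_sq_le hB0 δ y)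
  have hbayes := fun i => bayesRisk_le (τ := τ) hU hv i (hdi i) (hdK i)
  set F : EuclideanSpace ℝ (Fin p) × EuclideanSpace ℝ (Fin n) → ℝ := fun ω =>
    ∑ i, (d (bayesObs U τ ω) i - priorMean τ ω.1 i) ^ 2 with hF
  have hF0 : ∀ ω, 0 ≤ F ω := fun ω => Finset.sum_nonneg fun i _ => sq_nonneg _
  have hFint : Integrable F (jointLaw p n v) := integrable_finsetSum _ fun i _ => (hbayes i).1
  have hFle : ∑ i, v * τ i ^ 2 / (v + τ i ^ 2) ≤ ∫ ω, F ω ∂(jointLaw p n v) := by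
    rw [integral_finsetSum _ fun i _ => (hbayes i).1]
    exact Finset.sum_le_sum fun i _ => (hbayes i).2
  have hFm : Measurable F := by
    refine Finset.measurable_sum _ fun i _ => ?_
    have h1 := (hdi i).comp (continuous_bayesObs (U := U) (τ := τ)).measurable
    have h2 : Measurable fun ω : EuclideanSpace ℝ (Fin p) × EuclideanSpace ℝ (Fin n) =>
        priorMean τ ω.1 i := by
      unfold priorMean; fun_prop
    exact (h1.sub h2).pow_const 2
  obtain ⟨hQint, hQle⟩ := integral_priorAve_sub_sq_le hp hG
  -- Given the prior draw, the loss is controlled by `R` if the mean vector lies in the ellipsoid,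
  -- and by the squared deviation of `priorAve` otherwise.
  have hinner : ∀ g, ∫⁻ ε, ENNReal.ofReal (F (g, ε)) ∂(obsLaw 0 v) ≤
      p * R + ENNReal.ofReal (p * D * (priorAve a τ g - priorLevel a τ) ^ 2) := by
    intro g
    have hzero : ∀ i, a i = ∞ → priorMean τ g i = 0 := fun i hi => by simp [priorMean, hτ i hi]
    by_cases hg : priorAve a τ g ≤ v * r
    · have hmem : priorMean τ g ∈ ellipsoid r a v := mem_ellipsoid_of_sum_le hp hzero hg
      refine le_add_right ?_
      have h1 : risk p δ (meanOf U (priorMean τ g)) v ≤ R :=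
        le_iSup₂_of_le (priorMean τ g) hmem le_rfl
      have h2 : ∫⁻ ε, ENNReal.ofReal (F (g, ε)) ∂(obsLaw 0 v) ≤
          ∫⁻ y, ENNReal.ofReal (‖δ y - meanOf U (priorMean τ g)‖ ^ 2)
            ∂(obsLaw (meanOf U (priorMean τ g)) v) := by
        rw [obsLaw_eq_map (meanOf U _), lintegral_map
          (((hδ.sub_const _).norm.pow_const 2).ennreal_ofReal) (by fun_prop)]
        refine lintegral_mono fun ε => ENNReal.ofReal_le_ofReal ?_
        exact truncated_loss_le hU δ _ (sum_sq_le_of_mem_ellipsoid hp ha hr hv hmem)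
      refine h2.trans ?_
      have h3 := mul_le_mul_right h1 (p : ℝ≥0∞)
      rwa [risk, ENNReal.mul_div_cancel hpe hpt] at h3
    · push Not at hg
      refine le_add_left ?_
      refine (lintegral_mono (g := fun _ => ENNReal.ofReal (p * D *
        (priorAve a τ g - priorLevel a τ) ^ 2)) fun ε => ENNReal.ofReal_le_ofReal ?_).trans
        (by simp)
      have h1 : F (g, ε) ≤ 2 * (4 * B) + 2 * (p * priorAve a τ g) := by
        have h2 : ∑ i, priorMean τ g i ^ 2 ≤ p * priorAve a τ g := by
          rw [priorAve, mul_div_cancel₀ _ hp'.ne']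
          refine Finset.sum_le_sum fun i _ => ?_
          by_cases hi : a i = ∞
          · simp [hzero i hi]
          · have : (1 : ℝ) ≤ (a i).toReal := by
              have := ENNReal.toReal_mono hi (ha i)
              simpa using this
            nlinarith [sq_nonneg (priorMean τ g i)]
        have h3 := sum_truncated_sq_le (U := U) hB0 δ (bayesObs U τ (g, ε))
        have h4 : F (g, ε) ≤ 2 * ∑ i, d (bayesObs U τ (g, ε)) i ^ 2 +
            2 * ∑ i, priorMean τ g i ^ 2 := by
          rw [Finset.mul_sum, Finset.mul_sum, ← Finset.sum_add_distrib]
          exact Finset.sum_le_sum fun i _ => by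
            nlinarith [sq_nonneg (d (bayesObs U τ (g, ε)) i + priorMean τ g i)]
        linarith
      refine h1.trans ?_
      have hx : t ≤ priorAve a τ g - priorLevel a τ := by linarith
      have hq : priorLevel a τ ≤ v * r := by linarith
      set x := priorAve a τ g - priorLevel a τ with hxd
      have hQ : priorAve a τ g ≤ v * r + x := by linarith
      -- Outside the ellipsoid the deviation `x` is at least `t`, so constants and `x` itself are
      -- dominated by multiples of `x²`, as in Chebyshev's inequality. The `10` in `D` is `8` from
      -- the truncation plus `2` from `priorAve ≤ v r + x`.
      have e1 : 1 ≤ x ^ 2 / t ^ 2 := by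
        rw [le_div_iff₀ (by positivity)]; nlinarith
      have e2 : x ≤ x ^ 2 / t := by
        rw [le_div_iff₀ ht]; nlinarith
      have hvr : 0 < v * r := by positivity
      calc 2 * (4 * B) + 2 * (p * priorAve a τ g) ≤ 2 * (4 * B) + 2 * (p * (v * r + x)) := by
            gcongr
        _ = p * (10 * (v * r) * 1 + 2 * x) := by rw [hB]; ring
        _ ≤ p * (10 * (v * r) * (x ^ 2 / t ^ 2) + 2 * (x ^ 2 / t)) := by gcongr
        _ = p * D * x ^ 2 := by rw [hD]; ring
  have htotal : ENNReal.ofReal (∑ i, v * τ i ^ 2 / (v + τ i ^ 2)) ≤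
      p * R + ENNReal.ofReal (p * (D * (G ^ 2 * chiVar 1) / p)) := by
    calc ENNReal.ofReal (∑ i, v * τ i ^ 2 / (v + τ i ^ 2))
        ≤ ENNReal.ofReal (∫ ω, F ω ∂(jointLaw p n v)) := ENNReal.ofReal_le_ofReal hFle
      _ = ∫⁻ ω, ENNReal.ofReal (F ω) ∂(jointLaw p n v) :=
          ofReal_integral_eq_lintegral_ofReal hFint (ae_of_all _ hF0)
      _ = ∫⁻ g, ∫⁻ ε, ENNReal.ofReal (F (g, ε)) ∂(obsLaw 0 v) ∂(obsLaw 0 1) :=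
          lintegral_prod _ hFm.ennreal_ofReal.aemeasurable
      _ ≤ ∫⁻ g, (p * R + ENNReal.ofReal (p * D * (priorAve a τ g - priorLevel a τ) ^ 2))
            ∂(obsLaw 0 1) := lintegral_mono hinner
      _ = p * R + ENNReal.ofReal
            (∫ g, p * D * (priorAve a τ g - priorLevel a τ) ^ 2 ∂(obsLaw 0 1)) := by
          rw [lintegral_add_left measurable_const, lintegral_const, measure_univ, mul_one,
            ofReal_integral_eq_lintegral_ofReal (hQint.const_mul _)
              (ae_of_all _ fun g => by positivity)]
      _ ≤ _ := by
          gcongr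
          rw [integral_const_mul, mul_assoc, mul_div_assoc]
          gcongr
  rw [ENNReal.ofReal_div_of_pos hp', ENNReal.ofReal_natCast]
  refine (ENNReal.div_le_div_right htotal _).trans (le_of_eq ?_)
  rw [ENNReal.add_div, mul_comm (p : ℝ≥0∞) R, ENNReal.mul_div_cancel_right hpe hpt,
    ENNReal.ofReal_mul hp'.le, ENNReal.ofReal_natCast, mul_comm (p : ℝ≥0∞),
    ENNReal.mul_div_cancel_right hpe hpt]

/-- The remainder constant in the lower bound for the minimax risk. -/
def lowerConst (b r v ε : ℝ) : ℝ :=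
  (10 * (v * r) / (ε * (v * r)) ^ 2 + 2 / (ε * (v * r))) *
    ((v * (1 + 2 * r / b) ^ 2) ^ 2 * chiVar 1)

/-- A nonasymptotic lower bound for the maximal risk over the ellipsoid. -/
theorem pinskerValue_le_iSup_risk {b : ℝ} (hU : Uᵀ * U = 1) (hb0 : 0 < b) (hb1 : b ≤ 1)
    (hbp : 1 ≤ b * p) (ha : a ∈ weightClass b p) (hr : 0 < r) (hv : 0 < v) {ε : ℝ}
    (hε0 : 0 < ε) (hε1 : ε < 1)
    {δ : EuclideanSpace ℝ (Fin n) → EuclideanSpace ℝ (Fin n)} (hδ : Measurable δ) :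
    ENNReal.ofReal ((1 - ε) * pinskerValue r a v) ≤
      (⨆ ξ ∈ ellipsoid r a v, risk p δ (meanOf U ξ) v) +
        ENNReal.ofReal (lowerConst b r v ε / p) := by
  obtain ⟨i₀, h₀⟩ := exists_weight_eq_one hbp ha
  have hp : 0 < p := i₀.pos
  have hp' : (0 : ℝ) < p := by exact_mod_cast hp
  obtain ⟨hγ, hs⟩ := (isPinskerLevel_iff hp hr hv).1
    (isPinskerLevel_pinskerLevel (existsUnique_isPinskerLevel ha.2.1 h₀ hr hv).exists)
  rw [pinskerValue_eq r a hv]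
  set γ := pinskerLevel r a v
  have hγ1 : 1 < γ := one_lt_of_pinskerSum_pos ha.2.1 (by rw [hs]; positivity)
  set τ : Fin p → ℝ := fun i => Real.sqrt ((1 - ε) * v * pinskerUnit a γ i) with hτ
  have hm0 := pinskerUnit_nonneg a γ
  have hε : 0 < 1 - ε := by linarith
  have hτsq : ∀ i, τ i ^ 2 = (1 - ε) * v * pinskerUnit a γ i := fun i =>
    Real.sq_sqrt (mul_nonneg (by positivity) (hm0 i))
  have hlev : priorLevel a τ = (1 - ε) * (v * r) := by
    have : ∑ i, (a i).toReal * τ i ^ 2 = (1 - ε) * v * pinskerSum a γ := by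
      rw [pinskerSum, Finset.mul_sum]
      exact Finset.sum_congr rfl fun i _ => by rw [hτsq]; ring
    rw [priorLevel, this, hs]
    field_simp
  -- Shrinking the variances by `1 - ε` leaves the slack `t = ε v r` in the constraint.
  refine le_trans (ENNReal.ofReal_le_ofReal ?_)
    (bayes_le_iSup_risk (t := ε * (v * r)) (G := v * (1 + 2 * r / b) ^ 2) hU hp ha.2.1 hr hv
      (τ := τ) (fun i hi => by simp [hτ, pinskerUnit_of_top hi]) (by positivity)
      (by rw [hlev]; linarith) (fun i => ?_) hδ)
  · rw [← mul_div_assoc, ← mul_div_assoc]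
    refine div_le_div_of_nonneg_right ?_ hp'.le
    rw [Finset.mul_sum, Finset.mul_sum]
    refine Finset.sum_le_sum fun i _ => ?_
    rw [hτsq, pinskerFilter]
    have h1 := hm0 i
    generalize pinskerUnit a γ i = m at h1 ⊢
    have h2 : (1 - ε) * (v * (m / (1 + m))) = (1 - ε) * v * m / (1 + m) := by ring
    have h3 : v * ((1 - ε) * v * m) / (v + (1 - ε) * v * m) =
        (1 - ε) * v * m / (1 + (1 - ε) * m) := by
      field_simp
    rw [h2, h3]
    have h4 : 0 < 1 + (1 - ε) * m := by positivity
    refine div_le_div_of_nonneg_left (by positivity) h4 ?_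
    -- The shrunken denominator `1 + (1 - ε) m` is at most `1 + m`, so the Bayes risk drops by a
    -- factor no worse than `1 - ε`.
    nlinarith
  · rw [hτsq]
    have h1 := weight_mul_pinskerUnit_le_const hb0 hb1 hbp ha hγ1 hs i
    have h2 : 0 ≤ (a i).toReal * pinskerUnit a γ i :=
      mul_nonneg ENNReal.toReal_nonneg (hm0 i)
    calc (a i).toReal * ((1 - ε) * v * pinskerUnit a γ i)
        = (1 - ε) * (v * ((a i).toReal * pinskerUnit a γ i)) := by ring
      _ ≤ 1 * (v * ((a i).toReal * pinskerUnit a γ i)) := by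
          refine mul_le_mul_of_nonneg_right (by linarith) (by positivity)
      _ ≤ v * (1 + 2 * r / b) ^ 2 := by
          rw [one_mul]
          exact mul_le_mul_of_nonneg_left h1 hv.le

end Lower

/-! ### Measurability of the adaptive rule and passage to the limit. -/

/-- The adaptive estimator agrees almost surely with a measurable estimator. -/
theorem minimaxRisk_le_msEstimator {n p : ℕ} {U : Matrix (Fin n) (Fin p) ℝ} (hU : Uᵀ * U = 1)
    (hp : 0 < p) {v : ℝ} (hv : 0 < v) (r : ℝ) (a : Fin p → ℝ≥0∞)
    {s : EuclideanSpace ℝ (Fin n) → ℝ} (hs : Measurable s)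
    {fh : EuclideanSpace ℝ (Fin n) → Fin p → ℝ} (hfh : IsAdaptiveShrinkage U s fh) :
    minimaxRisk U r a v ≤ ⨆ ξ ∈ ellipsoid r a v, risk p (msEstimator U fh) (meanOf U ξ) v := by
  obtain ⟨G, hGm, hG⟩ := exists_measurable_riskMinimizer p
  set f' : EuclideanSpace ℝ (Fin n) → Fin p → ℝ := fun y => G (canonicalObs U y, s y) with hf'
  have hf'm : Measurable f' := hGm.comp ((continuous_canonicalObs U).measurable.prodMk hs)
  refine iInf₂_le_of_le (msEstimator U f') (measurable_msEstimator hf'm) (iSup₂_mono fun ξ _ => ?_)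
  refine le_of_eq ?_
  unfold risk
  congr 1
  refine lintegral_congr_ae ?_
  -- As `v > 0`, each canonical coordinate has an atomless law, so the minimizer is almost surely
  -- unique.
  have hne : ∀ᵐ y ∂(obsLaw (meanOf U ξ) v), ∀ i, canonicalObs U y i ≠ 0 := by
    refine ae_all_iff.2 fun i => ?_
    have hset : MeasurableSet {y | canonicalObs U y i ≠ 0} :=
      ((measurable_canonicalObs_apply U i) (measurableSet_singleton 0)).compl
    rw [obsLaw_eq_map, ae_map_iff (by fun_prop) hset]
    simp only [canonicalObs_add, canonicalObs_meanOf hU]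
    have hL := hasLaw_canonicalObs hU hv.le i
    have hnull : ∀ᵐ x ∂(gaussianReal 0 v.toNNReal), x ≠ -ξ i := by
      have := nullSingletonClass_gaussianReal (μ := 0) (v := v.toNNReal) (by simpa using hv)
      exact compl_mem_ae_iff.2 (measure_singleton _)
    have hset' : MeasurableSet {x : ℝ | x ≠ -ξ i} := (measurableSet_singleton _).compl
    rw [← hL.map_eq, ae_map_iff hL.aemeasurable hset'] at hnull
    filter_upwards [hnull] with ω hω h
    exact hω (by linarith)
  filter_upwards [hne] with y hy
  have : f' y = fh y := hG _ _ _ hy (hfh.isRiskMinimizer hp y)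
  simp only [msEstimator, this]

/-- The uniform lower bound `c` on `ν` turns additive errors into relative ones. -/
lemma tendsto_ratio_one {T : ℕ → ℝ≥0∞} {ν : ℕ → ℝ} {c : ℝ} (hc : 0 < c)
    (hν : ∀ᶠ p in atTop, c ≤ ν p) {C : ℝ → ℝ}
    (hlow : ∀ ε, 0 < ε → ε < 1 → ∀ᶠ p : ℕ in atTop,
      ENNReal.ofReal ((1 - ε) * ν p) ≤ T p + ENNReal.ofReal (C ε / p))
    {err : ℕ → ℝ≥0∞} (herr : Tendsto err atTop (𝓝 0))
    (hup : ∀ᶠ p in atTop, T p ≤ ENNReal.ofReal (ν p) + err p) :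
    Tendsto (fun p => T p / ENNReal.ofReal (ν p)) atTop (𝓝 1) := by
  refine tendsto_order.2 ⟨fun x hx => ?_, fun x hx => ?_⟩
  · have hxt : x ≠ ∞ := (hx.trans ENNReal.one_lt_top).ne
    obtain ⟨α, hα0, rfl⟩ : ∃ α : ℝ, 0 ≤ α ∧ x = ENNReal.ofReal α :=
      ⟨x.toReal, ENNReal.toReal_nonneg, (ENNReal.ofReal_toReal hxt).symm⟩
    have hα1 : α < 1 := by
      rwa [← ENNReal.ofReal_one, ENNReal.ofReal_lt_ofReal_iff one_pos] at hx
    -- Half of the gap `1 - α` pays for shrinking the prior, the other half for the remainder: `1 -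
    -- ε = α + ε`.
    have hε0 : 0 < (1 - α) / 2 := by linarith
    have hsmall : ∀ᶠ p : ℕ in atTop, max (C ((1 - α) / 2)) 0 / p < (1 - α) / 2 * c :=
      (tendsto_const_div_atTop_nhds_zero_nat _).eventually_lt_const (by positivity)
    filter_upwards [hν, hlow _ hε0 (by linarith), hsmall] with p h1 h2 h3
    rw [ENNReal.lt_div_iff_mul_lt (Or.inr ENNReal.ofReal_ne_top) (Or.inl ENNReal.ofReal_ne_top),
      ← ENNReal.ofReal_mul hα0]
    by_contra! h
    have h4 : C ((1 - α) / 2) / p ≤ max (C ((1 - α) / 2)) 0 / p :=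
      div_le_div_of_nonneg_right (le_max_left _ _) (Nat.cast_nonneg p)
    have h5 : 0 ≤ max (C ((1 - α) / 2)) 0 / (p : ℝ) := by positivity
    have h6 := h2.trans (add_le_add h (ENNReal.ofReal_le_ofReal h4))
    have hν0 : 0 < ν p := hc.trans_le h1
    rw [← ENNReal.ofReal_add (by positivity) h5,
      ENNReal.ofReal_le_ofReal_iff (by positivity)] at h6
    nlinarith
  · have hc' : ENNReal.ofReal c ≠ 0 := by simpa using hc
    have h1 : Tendsto (fun p => 1 + err p / ENNReal.ofReal c) atTop (𝓝 1) := by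
      have := (ENNReal.Tendsto.div_const herr (Or.inr hc')).const_add 1
      simpa using this
    filter_upwards [hν, hup, h1.eventually_lt_const hx] with p h2 h3 h4
    refine lt_of_le_of_lt ?_ h4
    have hν0 : ENNReal.ofReal (ν p) ≠ 0 := by simpa using hc.trans_le h2
    calc T p / ENNReal.ofReal (ν p)
        ≤ (ENNReal.ofReal (ν p) + err p) / ENNReal.ofReal (ν p) := ENNReal.div_le_div_right h3 _
      _ = 1 + err p / ENNReal.ofReal (ν p) := by
          rw [ENNReal.add_div, ENNReal.div_self hν0 ENNReal.ofReal_ne_top]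
      _ ≤ _ := by gcongr

end

end MonotoneShrinkage

open MonotoneShrinkage in
theorem theorem3p1
    -- for each dimension `p`, an orthonormal basis (the columns of `U p`) of a
    -- `p`-dimensional regression space in `ℝ^(n p)`
    (n : ℕ → ℕ) (U : ∀ p, Matrix (Fin (n p)) (Fin p) ℝ) (hU : ∀ p, (U p)ᵀ * U p = 1)
    (b : ℝ) (hb0 : 0 < b) (hb1 : b ≤ 1)
    (a : ∀ p, Fin p → ℝ≥0∞) (ha : ∀ p, a p ∈ weightClass b p)
    (r : ℝ) (hr : 0 < r) (v : ℝ) (hv : 0 < v) :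
    -- `γ` exists and is unique, as soon as `b p ≥ 1`
    (∀ p : ℕ, 1 ≤ b * p → ∃! γ : ℝ, IsPinskerLevel r (a p) v γ) ∧
    -- the asymptotic minimax risk
    Tendsto (fun p => minimaxRisk (U p) r (a p) v / ENNReal.ofReal (pinskerValue r (a p) v))
      atTop (𝓝 1) ∧
    -- the adaptive MS estimator attains it, for every variance estimator that is consistent
    -- in mean, uniformly over the ellipsoid
    (∀ (s : ∀ p, EuclideanSpace ℝ (Fin (n p)) → ℝ)
      (fhat : ∀ p, EuclideanSpace ℝ (Fin (n p)) → Fin p → ℝ),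
      (∀ p, Measurable (s p)) →
      Tendsto (fun p => ⨆ ξ ∈ ellipsoid r (a p) v, varianceError (s p) (meanOf (U p) ξ) v)
        atTop (𝓝 0) →
      (∀ p, IsAdaptiveShrinkage (U p) (s p) (fhat p)) →
      Tendsto (fun p => (⨆ ξ ∈ ellipsoid r (a p) v,
          risk p (msEstimator (U p) (fhat p)) (meanOf (U p) ξ) v) /
            ENNReal.ofReal (pinskerValue r (a p) v))
        atTop (𝓝 1)) := by
  have hex : ∀ p : ℕ, 1 ≤ b * p → ∃! γ : ℝ, IsPinskerLevel r (a p) v γ := fun p hp => by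
    obtain ⟨i₀, h₀⟩ := exists_weight_eq_one hp (ha p)
    exact existsUnique_isPinskerLevel (ha p).2.1 h₀ hr hv
  have hbig : ∀ᶠ p : ℕ in atTop, 1 ≤ b * p :=
    (tendsto_natCast_atTop_atTop.const_mul_atTop hb0).eventually_ge_atTop 1
  have hpos : ∀ᶠ p : ℕ in atTop, 0 < p := eventually_gt_atTop 0
  have hc : 0 < v * b * min 1 (r / 2) / 4 := by
    have : 0 < min 1 (r / 2) := lt_min one_pos (by linarith)
    positivity
  have hν : ∀ᶠ p : ℕ in atTop, v * b * min 1 (r / 2) / 4 ≤ pinskerValue r (a p) v := by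
    filter_upwards [hbig] with p hp using le_pinskerValue hb1 hp (ha p) hr hv
  have hlow : ∀ ε, 0 < ε → ε < 1 → ∀ᶠ p : ℕ in atTop,
      ENNReal.ofReal ((1 - ε) * pinskerValue r (a p) v) ≤
        minimaxRisk (U p) r (a p) v + ENNReal.ofReal (lowerConst b r v ε / p) := by
    intro ε hε0 hε1
    filter_upwards [hbig] with p hp
    -- With the remainder moved to the left, the infimum can be bounded one estimator at a time.
    rw [← tsub_le_iff_right]
    refine le_iInf₂ fun δ hδ => ?_
    rw [tsub_le_iff_right]
    exact pinskerValue_le_iSup_risk (hU p) hb0 hb1 hp (ha p) hr hv hε0 hε1 hδ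
  refine ⟨hex, ?_, fun s fhat hs hcons hfh => ?_⟩
  -- No error term here: the Pinsker filter meets the bound for each `p` with `b p ≥ 1`.
  · refine tendsto_ratio_one hc hν hlow tendsto_const_nhds (err := fun _ => 0) ?_
    filter_upwards [hbig, hpos] with p hp hp0
    rw [add_zero]
    exact minimaxRisk_le_pinskerValue (hU p) hp0 (ha p).2.1 hr hv (hex p hp).exists
  · refine tendsto_ratio_one (C := lowerConst b r v) hc hν ?_
      (err := fun p => ENNReal.ofReal ((2 + 16 * (v * (v * r) + chiVar v)) / Real.sqrt p) +
        2 * ⨆ ξ ∈ ellipsoid r (a p) v, varianceError (s p) (meanOf (U p) ξ) v) ?_ ?_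
    · intro ε hε0 hε1
      filter_upwards [hlow ε hε0 hε1, hpos] with p h1 hp0
      exact h1.trans (add_le_add_left
        (minimaxRisk_le_msEstimator (hU p) hp0 hv r (a p) (hs p) (hfh p)) _)
    · have h1 : Tendsto (fun p : ℕ => (2 + 16 * (v * (v * r) + chiVar v)) / Real.sqrt p)
          atTop (𝓝 0) :=
        tendsto_const_nhds.div_atTop (Real.tendsto_sqrt_atTop.comp tendsto_natCast_atTop_atTop)
      have h2 := (ENNReal.tendsto_ofReal h1).add
        (ENNReal.Tendsto.const_mul hcons (Or.inr (by simp : (2 : ℝ≥0∞) ≠ ∞)))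
      simpa using h2
    · filter_upwards [hbig, hpos] with p hp hp0
      refine iSup₂_le fun ξ hξ => ?_
      refine (risk_msEstimator_le (hU p) hp0 (ha p).2.1 (ha p).2.2 hr hv (hex p hp).exists
        (hfh p) hξ).trans ?_
      rw [add_assoc]
      gcongr
      exact le_iSup₂_of_le ξ hξ le_rfl
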